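/- Conventions. Let $h_m(x)=(2^m m!\sqrt\pi)^{-1/2}H_m(x)e^{-x^2/2}$, $m\ge 0$, be the Hermite functions (Fock basis of $L^2(\mathbb R)$), $H_m(x)=(-1)^m e^{x^2}\frac{d^m}{dx^m}e^{-x^2}$. A quantum state $\rho$ on $L^2(\mathbb R)$ (selfadjoint, positive, of trace one) is identified with its density matrix $\rho_{m,n}=\langle h_m,\rho h_n\rangle$. Its Wigner function $W_\rho$ is defined by its Fourier transform $\iint e^{-i(uq+vp)}W_\rho(q,p)\,dq\,dp=\mathrm{Tr}\big(\rho\exp(-iu\mathbf Q-iv\mathbf P)\big)$, with $\mathbf Q$ multiplication by $x$ and $\mathbf P=-i\,d/dx$. For $B>0$ and $0<r\le 2$ let $\mathcal R(B,r)$ be the set of states with $|\rho_{m,n}|\le\exp(-B(m+n)^{r/2})$ for all $m,n$. Let $(X_\ell,\Phi_\ell)$, $\ell=1,\dots,n$, be i.i.d. with density $p_\rho(x,\phi)=\int_{-\infty}^{\infty} W_\rho(x\cos\phi-t\sin\phi,\,x\sin\phi+t\cos\phi)\,dt$ with respect to $\frac1\pi$ times Lebesgue measure on $\mathbb R\times[0,\pi]$.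 One observes $(Y_\ell,\Phi_\ell)$, $\ell=1,\dots,n$, where $Y_\ell=\sqrt\eta X_\ell+\sqrt{(1-\eta)/2}\,\xi_\ell$ with $0<\eta<1$ known and $\xi_\ell$ i.i.d. standard Gaussian, independent of all the $(X_j,\Phi_j)$. Let $\widetilde N^\eta$ be the Fourier transform of the centered Gaussian density of variance $(1-\eta)/2$ and put $\gamma=\frac{1-\eta}{4\eta}$. For $h>0$ and $s>0$ set $$K_h^\eta(u)=\frac1{4\pi}\int_{-1/h}^{1/h}\frac{e^{-iut}|t|}{\widetilde N^\eta(t/\sqrt\eta)}\,dt,\qquad \widehat W_h^{\eta}(q,p)=\frac1n\sum_{\ell=1}^n K_h^\eta\Big(q\cos\Phi_\ell+p\sin\Phi_\ell-\frac{Y_\ell}{\sqrt\eta}\Big),$$ and let $\widehat W_h^{\eta,*}$ be $\widehat W_h^\eta$ multiplied by the indicator function of the disc $\{(q,p):q^2+p^2\le s^2\}$. Theorem 4 (minimax.l2.bounds). Let $B>0$, $0<\eta<1$ and $0<r\le2$, and let $s=s_n=1/h$. With the bandwidth $h=h_n$ given below, $\varphi_n^2\to0$ and there is a constant $0<C<\infty$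 such that $$\limsup_{n\to\infty}\ \sup_{\rho\in\mathcal R(B,r)}E\Big[\big\|\widehat W_h^{\eta,*}-W_\rho\big\|_{L^2(\mathbb R^2)}^2\Big]\,\varphi_n^{-2}\le C,$$ where: (i) for $r=2$, with $\beta=B/(1+\sqrt B)^2$: $\ h=\Big(\frac{2}{4\gamma+\beta}\log n+\frac1{4\gamma+\beta}\log\log n\Big)^{-1/2}$ and $\ \varphi_n^2=(\log n)^{\frac{16\gamma+3\beta}{8\gamma+2\beta}}\,n^{-\frac{\beta}{4\gamma+\beta}}$; (ii) for $0<r<2$ and any $0<\beta<B$: $h$ is the positive solution (which exists and is unique for all large $n$) of $\frac{2^{1-r}\beta}{h^r}+\frac{2\gamma}{h^2}=\log n-(\log\log n)^2$, and $\ \varphi_n^2=h^{3r-10}\exp\Big(-\frac{2^{1-r}\beta}{h^r}\Big)$. -/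

import Mathlib

open MeasureTheory ProbabilityTheory Filter Topology

noncomputable section

namespace QHT

/-! ### Quantum states on `L²(ℝ)` in the Fock basis -/

/-- The (physicists') Hermite polynomial `H_m(x) = (-1)^m e^{x²} (d/dx)^m e^{-x²}`. -/
def hermiteH (m : ℕ) (x : ℝ) : ℝ :=
  (-1) ^ m * Real.exp (x ^ 2) * iteratedDeriv m (fun t : ℝ => Real.exp (-t ^ 2)) x

/-- The Hermite function `h_m(x) = (2^m m! √π)^{-1/2} H_m(x) e^{-x²/2}`; these functions form
the Fock basis, an orthonormal basis of `L²(ℝ)`. -/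
def fock (m : ℕ) (x : ℝ) : ℝ :=
  (Real.sqrt (2 ^ m * (m.factorial : ℝ) * Real.sqrt Real.pi))⁻¹ * hermiteH m x
    * Real.exp (-x ^ 2 / 2)

open scoped ComplexOrder in
/-- A quantum state, identified with its density matrix `ρ m n = ⟨h_m, ρ h_n⟩` in the Fock
basis: selfadjoint, positive, of trace one. -/
def IsState (ρ : Matrix ℕ ℕ ℂ) : Prop :=
  ρ.IsHermitian ∧ ρ.PosSemidef ∧ HasSum (fun n => ρ n n) 1

/-- The class `𝓡(B, r)` of quantum states with `|ρ_{m,n}| ≤ exp(-B (m+n)^{r/2})`. -/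
def stateClass (B r : ℝ) : Set (Matrix ℕ ℕ ℂ) :=
  {ρ | IsState ρ ∧ ∀ m n : ℕ, ‖ρ m n‖ ≤ Real.exp (-B * ((m : ℝ) + (n : ℝ)) ^ (r / 2))}

/-! ### The Wigner function -/

/-- The unitary `exp(-iu𝐐 - iv𝐏)` acting on functions, where `𝐐` is multiplication by `x` and
`𝐏 = -i d/dx` (so `[𝐐, 𝐏] = i`): by the Baker-Campbell-Hausdorff formula it equals
`e^{iuv/2} e^{-iu𝐐} e^{-iv𝐏}`, i.e. it sends `f` to `x ↦ e^{iuv/2 - iux} f(x - v)`. -/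
def weyl (u v : ℝ) (f : ℝ → ℂ) (x : ℝ) : ℂ :=
  Complex.exp (Complex.I * ((u * v / 2 - u * x : ℝ) : ℂ)) * f (x - v)

/-- The matrix element `⟨h_n, exp(-iu𝐐 - iv𝐏) h_m⟩` (the `h_n` are real). -/
def weylCoeff (u v : ℝ) (n m : ℕ) : ℂ :=
  ∫ x : ℝ, (fock n x : ℂ) * weyl u v (fun y => (fock m y : ℂ)) x

/-- `Tr(ρ exp(-iu𝐐 - iv𝐏))`, the trace being taken in the Fock basis. This is the Fourier
transform `∬ e^{-i(uq+vp)} W_ρ(q,p) dq dp` of the Wigner function. -/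
def wignerFourier (ρ : Matrix ℕ ℕ ℂ) (u v : ℝ) : ℂ :=
  ∑' m : ℕ, ∑' n : ℕ, ρ m n * weylCoeff u v n m

/-- The Wigner function `W_ρ`, the inverse Fourier transform of `Tr(ρ exp(-iu𝐐 - iv𝐏))`.
The integral is real, because `Tr(ρ exp(iu𝐐 + iv𝐏))` is the conjugate of
`Tr(ρ exp(-iu𝐐 - iv𝐏))`. -/
def wigner (ρ : Matrix ℕ ℕ ℂ) (q p : ℝ) : ℝ :=
  (1 / (4 * (Real.pi : ℂ) ^ 2) * ∫ w : ℝ × ℝ,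
    Complex.exp (Complex.I * ((w.1 * q + w.2 * p : ℝ) : ℂ)) * wignerFourier ρ w.1 w.2).re

/-- The Radon transform `𝓡[W](x, φ)`. -/
def radon (W : ℝ → ℝ → ℝ) (x φ : ℝ) : ℝ :=
  ∫ t : ℝ, W (x * Real.cos φ - t * Real.sin φ) (x * Real.sin φ + t * Real.cos φ)

/-! ### The statistical model -/

/-- The law `P_ρ` of `(X, Φ)`: density `p_ρ = 𝓡[W_ρ]` with respect to `1/π` times Lebesgue
measure on `ℝ × [0, π]`. -/
def idealLaw (ρ : Matrix ℕ ℕ ℂ) : Measure (ℝ × ℝ) :=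
  (ENNReal.ofReal (1 / Real.pi) •
    (volume.restrict (Set.univ ×ˢ Set.Icc 0 Real.pi) : Measure (ℝ × ℝ))).withDensity
      (fun z => ENNReal.ofReal (radon (wigner ρ) z.1 z.2))

/-- The law of `(Y, Φ)` with `Y = √η X + √((1-η)/2) ξ`, where `(X, Φ) ∼ P_ρ` and `ξ` is an
independent standard Gaussian. -/
def noisyLaw (η : ℝ) (ρ : Matrix ℕ ℕ ℂ) : Measure (ℝ × ℝ) :=
  ((idealLaw ρ).prod (gaussianReal 0 1)).map
    (fun ω => (Real.sqrt η * ω.1.1 + Real.sqrt ((1 - η) / 2) * ω.2, ω.1.2))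

/-! ### The estimator -/

/-- Fourier transform `∫ e^{-itx} N^η(x) dx` of the centered Gaussian density `N^η` of
variance `(1-η)/2`. -/
def noiseFourier (η t : ℝ) : ℂ :=
  ∫ x : ℝ, Complex.exp (-(Complex.I * (t * x : ℝ)))
    * (gaussianPDFReal 0 (Real.toNNReal ((1 - η) / 2)) x : ℂ)

/-- The kernel
`K_h^η(u) = (1/4π) ∫_{-1/h}^{1/h} e^{-iut} |t| / Ñ^η(t/√η) dt`.
The integral is real, because `|t| / Ñ^η(t/√η)` is real and even in `t`. -/
def kernel (η h u : ℝ) : ℝ :=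
  (1 / (4 * (Real.pi : ℂ)) * ∫ t in (-(1 / h))..(1 / h),
    Complex.exp (-(Complex.I * (u * t : ℝ))) * (|t| : ℝ)
      / noiseFourier η (t / Real.sqrt η)).re

/-- The kernel estimator
`Ŵ_h^η(q,p) = (1/n) ∑_ℓ K_h^η(q cos Φ_ℓ + p sin Φ_ℓ - Y_ℓ/√η)` computed from the data
`d ℓ = (Y_ℓ, Φ_ℓ)`. -/
def estimator (η h : ℝ) {n : ℕ} (d : Fin n → ℝ × ℝ) (q p : ℝ) : ℝ :=
  1 / (n : ℝ) * ∑ l : Fin n,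
    kernel η h (q * Real.cos (d l).2 + p * Real.sin (d l).2 - (d l).1 / Real.sqrt η)

/-- The disc `D(s) = {(q,p) : ‖(q,p)‖ ≤ s}` for the Euclidean norm. -/
def disc (s : ℝ) : Set (ℝ × ℝ) := {z | Real.sqrt (z.1 ^ 2 + z.2 ^ 2) ≤ s}

/-- The estimator truncated to the disc `D(s)`. -/
def truncEstimator (η h s : ℝ) {n : ℕ} (d : Fin n → ℝ × ℝ) : ℝ × ℝ → ℝ :=
  (disc s).indicator (fun z => estimator η h d z.1 z.2)

/-- The risk `E ‖Ŵ_h^{η,*} - W_ρ‖₂²` for `n` i.i.d. observations of law `noisyLaw η ρ`. -/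
def risk (η h s : ℝ) (n : ℕ) (ρ : Matrix ℕ ℕ ℂ) : ENNReal :=
  ∫⁻ d : Fin n → ℝ × ℝ,
    (∫⁻ z : ℝ × ℝ, ENNReal.ofReal ((truncEstimator η h s d z - wigner ρ z.1 z.2) ^ 2))
      ∂(Measure.pi fun _ => noisyLaw η ρ)

/-- The truncated estimator with bandwidths `h n` and radii `s n` satisfies over `𝓡(B, r)` the
maximal risk bound with squared rate `φ2 n`: the sequence `φ2` tends to `0`, and
`limsup_n sup_{ρ ∈ 𝓡(B,r)} E ‖Ŵ_h^{η,*} - W_ρ‖₂² / φ2 n ≤ C` for some constant `C`. -/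
def AttainsRate (B r η : ℝ) (h s φ2 : ℕ → ℝ) : Prop :=
  Tendsto φ2 atTop (𝓝 0) ∧
    ∃ C : ℝ, 0 < C ∧
      limsup (fun n : ℕ =>
        (⨆ ρ ∈ stateClass B r, risk η (h n) (s n) n ρ) / ENNReal.ofReal (φ2 n)) atTop
          ≤ ENNReal.ofReal C

/-- For `n` observations, `h` is a (positive) solution of
`2^{1-r} β / h^r + 2γ / h² = log n - (log log n)²`. -/
def IsBandwidth (r β γ : ℝ) (n : ℕ) (h : ℝ) : Prop :=
  0 < h ∧ (2 : ℝ) ^ (1 - r) * β / h ^ r + 2 * γ / h ^ 2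
    = Real.log n - (Real.log (Real.log n)) ^ 2

end QHT

end

noncomputable section

namespace QHT

/-! ### Hermite functions -/

/-! The proof is a bias-variance bound whose analytic input is decay of the Wigner function and of
its Fourier transform, uniformly over the class. Everything rests on the matrix elements of the Weyl
operators between Hermite functions. Ladder relations show that a phase-space rotation multiplies
them by a phase only, so their size may be computed at `u = 0`, where it is at most the integral of
|h_n(x) h_m(x - v)|. An Agmon estimate for the harmonic oscillator then gives the bound exp((n+m+1)
τ/(1-τ²) - τ(u²+v²)/4) for every 0 ≤ τ < 1 (`norm_weylCoeff_le`).

Combined with |ρ_{m,n}| ≤ exp(-B(m+n)^{r/2}), this yields decay exp(-b(‖w‖/2)^r) of `wignerFourier`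
at w, for every b < B/(1+B) if r = 2 and every b < B if r < 2 (`exists_decayPair_one`,
`exists_decayPair_lt_one`). The Wigner function is, up to signs and the factor 1/π, the same series
at a rotated and doubled point (`HasDecay.wigner_eq`), so it decays too.

The Fourier slice theorem and the Gaussian noise show that the kernel undoes the noise exactly: the
mean of the estimator is the inverse Fourier integral of `wignerFourier` restricted to the disc of
radius 1/h (`HasDecay.integral_kernel_noisyLaw`). The bias is therefore a Fourier tail, the variance
is at most the squared sup norm of the kernel over n, and outside the truncation disc the error is
the tail of the Wigner function. Since the disc has area of order h^{-2}, the risk is at most a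
constant times h^{-2}(exp(2γ/h²)/n + exp(-2^{1-r}β/h^r)), the constant depending on the class and
not on the state (`exists_risk_le`). Taking b strictly above β leaves an integrable factor in every
tail.

It remains to insert the bandwidth. The stated rates have room: a factor of order (log n)^{1/2} at r
= 2, and h^{3r-10} against h^{-2} for r < 2. -/

/-- The physicists' Hermite polynomials, defined by `P_{n+1} = 2 X P_n - P_n'`. -/
def hermitePoly : ℕ → Polynomial ℝ
  | 0 => 1
  | n + 1 => 2 * Polynomial.X * hermitePoly n - Polynomial.derivative (hermitePoly n)

lemma derivative_hermitePoly (n : ℕ) :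
    Polynomial.derivative (hermitePoly n) = 2 * (n : Polynomial ℝ) * hermitePoly (n - 1) := by
  induction n with
  | zero => simp [hermitePoly]
  | succ n ih =>
    rw [hermitePoly, Polynomial.derivative_sub, Polynomial.derivative_mul, ih]
    rcases n with _ | n
    · simp [hermitePoly]
    · simp only [Nat.add_sub_cancel, hermitePoly] at ih ⊢
      simp only [Polynomial.derivative_mul, Polynomial.derivative_X, Polynomial.derivative_ofNat,
        Polynomial.derivative_natCast]
      push_cast
      ring

lemma iteratedDeriv_gaussian (m : ℕ) :
    iteratedDeriv m (fun t : ℝ => Real.exp (-t ^ 2)) =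
      fun x => (-1) ^ m * (hermitePoly m).eval x * Real.exp (-x ^ 2) := by
  induction m with
  | zero => ext x; simp [hermitePoly]
  | succ m ih =>
    ext x
    rw [iteratedDeriv_succ, ih]
    have h1 : HasDerivAt (fun x : ℝ => Real.exp (-x ^ 2)) (Real.exp (-x ^ 2) * (-(2 * x))) x := by
      simpa using ((hasDerivAt_pow 2 x).neg).exp
    have h2 := (((hermitePoly m).hasDerivAt x).const_mul ((-1 : ℝ) ^ m)).mul h1
    refine h2.deriv.trans ?_
    rw [hermitePoly]
    simp [pow_succ]
    ring

lemma hermiteH_eq (m : ℕ) (x : ℝ) : hermiteH m x = (hermitePoly m).eval x := by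
  have h : ((-1 : ℝ) ^ m) * (-1) ^ m = 1 := by rw [← mul_pow]; simp
  rw [hermiteH, iteratedDeriv_gaussian]
  simp only [Real.exp_neg]
  field_simp
  linear_combination (hermitePoly m).eval x * h

/-- The normalizing constant of the Hermite functions. -/
def fockConst (m : ℕ) : ℝ := (Real.sqrt (2 ^ m * (m.factorial : ℝ) * Real.sqrt Real.pi))⁻¹

lemma fockConst_succ (m : ℕ) :
    fockConst m = Real.sqrt (2 * (m + 1)) * fockConst (m + 1) := by
  unfold fockConst
  have h : (2 : ℝ) ^ (m + 1) * ((m + 1).factorial : ℝ) * Real.sqrt Real.pi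
      = 2 * (m + 1) * (2 ^ m * (m.factorial : ℝ) * Real.sqrt Real.pi) := by
    rw [Nat.factorial_succ]; push_cast; ring
  have h2 : 0 < Real.sqrt (2 * ((m : ℝ) + 1)) := Real.sqrt_pos.2 (by positivity)
  rw [h, Real.sqrt_mul (x := 2 * ((m : ℝ) + 1)) (by positivity), mul_inv, ← mul_assoc,
    mul_inv_cancel₀ h2.ne', one_mul]

lemma fock_eq (m : ℕ) (x : ℝ) :
    fock m x = fockConst m * (hermitePoly m).eval x * Real.exp (-x ^ 2 / 2) := by
  rw [fock, hermiteH_eq]; rfl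

lemma hasDerivAt_fock_aux (n : ℕ) (x : ℝ) :
    HasDerivAt (fock n) (fockConst n * ((hermitePoly n).derivative.eval x
      - x * (hermitePoly n).eval x) * Real.exp (-x ^ 2 / 2)) x := by
  have h1 : HasDerivAt (fun x : ℝ => Real.exp (-x ^ 2 / 2)) (Real.exp (-x ^ 2 / 2) * (-x)) x := by
    have := ((hasDerivAt_pow 2 x).neg.div_const 2).exp
    refine this.congr_deriv ?_
    simp
    ring
  have h2 := (((hermitePoly n).hasDerivAt x).const_mul (fockConst n)).mul h1
  have h3 : fock n = fun x => fockConst n * (hermitePoly n).eval x * Real.exp (-x ^ 2 / 2) :=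
    funext (fock_eq n)
  rw [h3]
  exact h2.congr_deriv (by ring)

/-- The creation operator. -/
lemma hasDerivAt_fock (n : ℕ) (x : ℝ) :
    HasDerivAt (fock n) (x * fock n x - Real.sqrt (2 * (n + 1)) * fock (n + 1) x) x := by
  refine (hasDerivAt_fock_aux n x).congr_deriv ?_
  rw [fock_eq, fock_eq, fockConst_succ n, hermitePoly]
  simp
  ring

/-- The annihilation operator. -/
lemma hasDerivAt_fock' (n : ℕ) (x : ℝ) :
    HasDerivAt (fock n) (-x * fock n x + Real.sqrt (2 * n) * fock (n - 1) x) x := by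
  refine (hasDerivAt_fock_aux n x).congr_deriv ?_
  rw [derivative_hermitePoly]
  rcases n with _ | n
  · simp [fock_eq]; ring
  · have h : Real.sqrt (2 * ((n + 1 : ℕ) : ℝ)) * fockConst n = 2 * (n + 1) * fockConst (n + 1) := by
      rw [fockConst_succ n]
      push_cast
      rw [← mul_assoc, Real.mul_self_sqrt (by positivity)]
    simp only [Nat.add_sub_cancel, fock_eq]
    rw [← mul_assoc (Real.sqrt _), ← mul_assoc (Real.sqrt _), h]
    simp
    ring

lemma continuous_fock (n : ℕ) : Continuous (fock n) :=
  continuous_iff_continuousAt.2 fun x => (hasDerivAt_fock n x).continuousAt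

lemma fock_neg (n : ℕ) (x : ℝ) : fock n (-x) = (-1) ^ n * fock n x := by
  have key : ∀ n : ℕ, (hermitePoly n).comp (-Polynomial.X) = (-1) ^ n * hermitePoly n := by
    intro n
    induction n using Nat.strong_induction_on with
    | _ n ih =>
      rcases n with _ | n
      · simp [hermitePoly]
      · rw [hermitePoly, derivative_hermitePoly]
        have h1 := ih n (by omega)
        rcases n with _ | n
        · simp [hermitePoly]
        · have h2 := ih n (by omega)
          simp only [Nat.add_sub_cancel, Polynomial.sub_comp, Polynomial.mul_comp, h1, h2]
          simp
          ring
  have h := congrArg (Polynomial.eval x) (key n)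
  simp only [Polynomial.eval_comp, Polynomial.eval_neg, Polynomial.eval_X, Polynomial.eval_mul,
    Polynomial.eval_pow, Polynomial.eval_one] at h
  rw [fock_eq, fock_eq, h]
  simp
  ring

lemma integrable_poly_mul_gaussian (p : Polynomial ℝ) {c : ℝ} (hc : 0 < c) :
    Integrable (fun x : ℝ => p.eval x * Real.exp (-c * x ^ 2)) := by
  induction p using Polynomial.induction_on' with
  | add p q hp hq =>
    simp only [Polynomial.eval_add, add_mul]
    exact hp.add hq
  | monomial n a =>
    have := (integrable_rpow_mul_exp_neg_mul_sq hc (s := n)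
      (by have : (0 : ℝ) ≤ n := n.cast_nonneg
          linarith)).const_mul a
    simpa [mul_assoc] using this

/-- The weighted product of two Hermite functions is integrable. -/
lemma integrable_weighted (p : Polynomial ℝ) {τ : ℝ} (hτ : τ < 1) (n m : ℕ) :
    Integrable (fun x : ℝ => p.eval x * Real.exp (τ * x ^ 2) * (fock n x * fock m x)) := by
  refine (integrable_poly_mul_gaussian (Polynomial.C (fockConst n * fockConst m) *
    (p * hermitePoly n * hermitePoly m)) (c := 1 - τ) (by linarith)).congr
    (Eventually.of_forall fun x => ?_)
  have h : Real.exp (-(1 - τ) * x ^ 2)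
      = Real.exp (τ * x ^ 2) * (Real.exp (-x ^ 2 / 2) * Real.exp (-x ^ 2 / 2)) := by
    rw [← Real.exp_add, ← Real.exp_add]; ring_nf
  simp only [fock_eq, Polynomial.eval_mul, Polynomial.eval_C, h]
  ring

lemma integrable_fock_mul (n m : ℕ) : Integrable (fun x : ℝ => fock n x * fock m x) := by
  simpa using integrable_weighted 1 (τ := 0) zero_lt_one n m

lemma memLp_fock (n : ℕ) : MemLp (fock n) 2 := by
  refine (memLp_two_iff_integrable_sq (continuous_fock n).aestronglyMeasurable).2 ?_
  simpa [sq] using integrable_fock_mul n n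

lemma integrable_fock_mul_shift (n m : ℕ) (v : ℝ) :
    Integrable (fun x : ℝ => fock n x * fock m (x - v)) :=
  (memLp_fock n).integrable_mul ((memLp_fock m).comp_measurePreserving
    (measurePreserving_sub_right volume v))

/-! ### Matrix elements of the Weyl operators -/

lemma norm_weyl_phase (u v x : ℝ) :
    ‖Complex.exp (Complex.I * ((u * v / 2 - u * x : ℝ) : ℂ))‖ = 1 := by
  rw [mul_comm, Complex.norm_exp_ofReal_mul_I]

lemma integrable_weylCoeff (u v : ℝ) (n m : ℕ) :
    Integrable (fun x : ℝ => (fock n x : ℂ) * weyl u v (fun y => (fock m y : ℂ)) x) := by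
  refine (integrable_fock_mul_shift n m v).mono ?_ (Eventually.of_forall fun x => ?_)
  · refine Continuous.aestronglyMeasurable ?_
    unfold weyl
    have := continuous_fock n
    have := continuous_fock m
    fun_prop
  · simp only [weyl, norm_mul, norm_weyl_phase, Complex.norm_real]
    simp

lemma hasDerivAt_weylCoeff_integrand (u v : ℝ) {f g : ℝ → ℝ} {f' g' x : ℝ}
    (hf : HasDerivAt f f' x) (hg : HasDerivAt g g' (x - v)) :
    HasDerivAt (fun x : ℝ => (f x : ℂ) * weyl u v (fun y => (g y : ℂ)) x)
      (Complex.exp (Complex.I * ((u * v / 2 - u * x : ℝ) : ℂ)) *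
        (f' * g (x - v) - Complex.I * u * (f x * g (x - v)) + f x * g')) x := by
  have h1 : HasDerivAt (fun x : ℝ => Complex.exp (Complex.I * ((u * v / 2 - u * x : ℝ) : ℂ)))
      (Complex.exp (Complex.I * ((u * v / 2 - u * x : ℝ) : ℂ)) * (Complex.I * ((-u : ℝ) : ℂ))) x := by
    refine HasDerivAt.cexp (HasDerivAt.const_mul _ ?_)
    refine HasDerivAt.ofReal_comp ?_
    simpa using ((hasDerivAt_id x).const_mul u).const_sub (u * v / 2)
  have h2 : HasDerivAt (fun x : ℝ => ((g (x - v) : ℝ) : ℂ)) (g' : ℂ) x :=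
    (hg.comp_sub_const x v).ofReal_comp
  refine (hf.ofReal_comp.mul (h1.mul h2)).congr_deriv ?_
  simp only [Pi.mul_apply]
  push_cast
  ring

/-- The integral of a derivative vanishes. Applied to the integrand of the matrix element, with the
creation form of the derivative on `fock n` and the annihilation form on `fock m`, the terms linear
in `x` cancel up to the shift `v`. At `m = 0` the truncated `m - 1` is harmless because its
coefficient is zero. Together with `weylCoeff_zero_succ` and `weylCoeff_zero_zero` this determines
every matrix element by induction. -/
lemma weylCoeff_succ_left (u v : ℝ) (n m : ℕ) :
    (Real.sqrt (2 * (n + 1)) : ℂ) * weylCoeff u v (n + 1) m =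
      (v - Complex.I * u) * weylCoeff u v n m
        + (Real.sqrt (2 * m) : ℂ) * weylCoeff u v n (m - 1) := by
  have hd := fun x : ℝ => hasDerivAt_weylCoeff_integrand u v (hasDerivAt_fock n x)
    (hasDerivAt_fock' m (x - v))
  have e : (fun x : ℝ => Complex.exp (Complex.I * ((u * v / 2 - u * x : ℝ) : ℂ)) *
        (((x * fock n x - Real.sqrt (2 * (n + 1)) * fock (n + 1) x : ℝ) : ℂ) * fock m (x - v)
          - Complex.I * u * (fock n x * fock m (x - v))
          + fock n x * ((-(x - v) * fock m (x - v)
            + Real.sqrt (2 * m) * fock (m - 1) (x - v) : ℝ) : ℂ))) =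
      fun x => (v - Complex.I * u) * ((fock n x : ℂ) * weyl u v (fun y => (fock m y : ℂ)) x)
        + (Real.sqrt (2 * m) : ℂ) *
          ((fock n x : ℂ) * weyl u v (fun y => (fock (m - 1) y : ℂ)) x)
        - (Real.sqrt (2 * (n + 1)) : ℂ) *
          ((fock (n + 1) x : ℂ) * weyl u v (fun y => (fock m y : ℂ)) x) := by
    ext x
    simp only [weyl]
    push_cast
    ring
  have i1 := (integrable_weylCoeff u v n m).const_mul (v - Complex.I * u)
  have i2 := (integrable_weylCoeff u v n (m - 1)).const_mul (Real.sqrt (2 * m) : ℂ)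
  have i3 := (integrable_weylCoeff u v (n + 1) m).const_mul (Real.sqrt (2 * (n + 1)) : ℂ)
  have h0 := integral_eq_zero_of_hasDerivAt_of_integrable hd
    (by rw [e]; exact (i1.add i2).sub i3) (integrable_weylCoeff u v n m)
  rw [e, integral_sub (f := fun x => _ + _) (i1.add i2) i3, integral_add i1 i2, integral_const_mul, integral_const_mul,
    integral_const_mul] at h0
  exact (sub_eq_zero.1 h0).symm

/-- The same integration with the two ladder forms exchanged; the annihilation term disappears
because the left function is the ground state. -/
lemma weylCoeff_zero_succ (u v : ℝ) (m : ℕ) :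
    (Real.sqrt (2 * (m + 1)) : ℂ) * weylCoeff u v 0 (m + 1) =
      -(v + Complex.I * u) * weylCoeff u v 0 m := by
  have hd := fun x : ℝ => hasDerivAt_weylCoeff_integrand u v (hasDerivAt_fock' 0 x)
    (hasDerivAt_fock m (x - v))
  have e : (fun x : ℝ => Complex.exp (Complex.I * ((u * v / 2 - u * x : ℝ) : ℂ)) *
        (((-x * fock 0 x + Real.sqrt (2 * (0 : ℕ)) * fock (0 - 1) x : ℝ) : ℂ) * fock m (x - v)
          - Complex.I * u * (fock 0 x * fock m (x - v))
          + fock 0 x * (((x - v) * fock m (x - v)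
            - Real.sqrt (2 * (m + 1)) * fock (m + 1) (x - v) : ℝ) : ℂ))) =
      fun x => -(v + Complex.I * u) * ((fock 0 x : ℂ) * weyl u v (fun y => (fock m y : ℂ)) x)
        - (Real.sqrt (2 * (m + 1)) : ℂ) *
          ((fock 0 x : ℂ) * weyl u v (fun y => (fock (m + 1) y : ℂ)) x) := by
    ext x
    simp only [weyl]
    push_cast
    simp
    ring
  have i1 := (integrable_weylCoeff u v 0 m).const_mul (-(v + Complex.I * u))
  have i3 := (integrable_weylCoeff u v 0 (m + 1)).const_mul (Real.sqrt (2 * (m + 1)) : ℂ)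
  have h0 := integral_eq_zero_of_hasDerivAt_of_integrable hd
    (by rw [e]; exact i1.sub i3) (integrable_weylCoeff u v 0 m)
  rw [e, integral_sub i1 i3, integral_const_mul, integral_const_mul] at h0
  exact (sub_eq_zero.1 h0).symm

/-- Completing the square around the midpoint `v / 2` turns the integral into the Fourier transform
of a Gaussian. -/
lemma weylCoeff_zero_zero (u v : ℝ) :
    weylCoeff u v 0 0 = Real.exp (-(u ^ 2 + v ^ 2) / 4) := by
  have hc : fockConst 0 ^ 2 * Real.sqrt Real.pi = 1 := by
    have : 0 < Real.sqrt Real.pi := Real.sqrt_pos.2 Real.pi_pos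
    simp [fockConst, Real.sq_sqrt this.le, this.ne']
  have h : ∀ x : ℝ, (fock 0 x : ℂ) * weyl u v (fun y => (fock 0 y : ℂ)) x
      = (fockConst 0 ^ 2 * Real.exp (-v ^ 2 / 4) : ℝ) *
        (fun y : ℝ => Complex.exp (Complex.I * ((-u : ℝ) : ℂ) * y)
          * Complex.exp (-(1 : ℂ) * (y : ℂ) ^ 2)) (x - v / 2) := by
    intro x
    simp only [weyl, fock_eq, hermitePoly, Polynomial.eval_one]
    push_cast
    have e : Complex.exp (-(x : ℂ) ^ 2 / 2) * (Complex.exp (Complex.I * (u * v / 2 - u * x)) *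
        Complex.exp (-((x : ℂ) - v) ^ 2 / 2)) = Complex.exp (-(v : ℂ) ^ 2 / 4) *
        (Complex.exp (Complex.I * -u * (x - v / 2)) * Complex.exp (-1 * ((x : ℂ) - v / 2) ^ 2)) := by
      simp only [← Complex.exp_add]
      congr 1
      ring
    linear_combination (fockConst 0 : ℂ) ^ 2 * e
  unfold weylCoeff
  simp_rw [h]
  rw [integral_const_mul, integral_sub_right_eq_self
    (fun y : ℝ => Complex.exp (Complex.I * ((-u : ℝ) : ℂ) * y)
          * Complex.exp (-(1 : ℂ) * (y : ℂ) ^ 2)) (v / 2),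
    fourierIntegral_gaussian (by simp) ((-u : ℝ) : ℂ)]
  have hpi : ((Real.pi : ℂ) / 1) ^ (1 / 2 : ℂ) = (Real.sqrt Real.pi : ℂ) := by
    rw [Real.sqrt_eq_rpow, Complex.ofReal_cpow Real.pi_pos.le]; simp
  rw [hpi]
  have he : Real.exp (-(u ^ 2 + v ^ 2) / 4) = Real.exp (-v ^ 2 / 4) * Real.exp (-u ^ 2 / 4) := by
    rw [← Real.exp_add]; ring_nf
  have he2 : Complex.exp (-((-u : ℝ) : ℂ) ^ 2 / (4 * 1)) = (Real.exp (-u ^ 2 / 4) : ℂ) := by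
    push_cast; ring_nf
  rw [he, he2, ← Complex.ofReal_mul, ← Complex.ofReal_mul]
  congr 1
  linear_combination Real.exp (-v ^ 2 / 4) * Real.exp (-u ^ 2 / 4) * hc

lemma sqrt_two_mul_succ_ne_zero (n : ℕ) : (Real.sqrt (2 * (n + 1)) : ℂ) ≠ 0 := by
  have : 0 < Real.sqrt (2 * ((n : ℝ) + 1)) := Real.sqrt_pos.2 (by positivity)
  exact_mod_cast this.ne'

lemma continuous_weylCoeff (n m : ℕ) :
    Continuous (fun w : ℝ × ℝ => weylCoeff w.1 w.2 n m) := by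
  induction n generalizing m with
  | zero =>
    induction m with
    | zero => simp_rw [weylCoeff_zero_zero]; fun_prop
    | succ m ih =>
      have : (fun w : ℝ × ℝ => weylCoeff w.1 w.2 0 (m + 1)) = fun w =>
          (Real.sqrt (2 * (m + 1)) : ℂ)⁻¹ *
            (-(w.2 + Complex.I * w.1) * weylCoeff w.1 w.2 0 m) := by
        ext w
        rw [← weylCoeff_zero_succ, inv_mul_cancel_left₀ (sqrt_two_mul_succ_ne_zero m)]
      rw [this]
      fun_prop
  | succ n ih =>
    have : (fun w : ℝ × ℝ => weylCoeff w.1 w.2 (n + 1) m) = fun w =>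
        (Real.sqrt (2 * (n + 1)) : ℂ)⁻¹ * ((w.2 - Complex.I * w.1) * weylCoeff w.1 w.2 n m
        + (Real.sqrt (2 * m) : ℂ) * weylCoeff w.1 w.2 n (m - 1)) := by
      ext w
      rw [← weylCoeff_succ_left, inv_mul_cancel_left₀ (sqrt_two_mul_succ_ne_zero n)]
    rw [this]
    have := ih m
    have := ih (m - 1)
    fun_prop

/-- Covariance of the matrix elements under rotations of the phase space. -/
lemma weylCoeff_rotate {u v u' v' θ : ℝ}
    (h : (v' : ℂ) - Complex.I * u' = Complex.exp (θ * Complex.I) * (v - Complex.I * u))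
    (n m : ℕ) :
    weylCoeff u' v' n m = Complex.exp (n * θ * Complex.I) * Complex.exp (-(m * θ * Complex.I))
      * weylCoeff u v n m := by
  have hconj : (v' : ℂ) + Complex.I * u' = Complex.exp (-(θ * Complex.I)) * (v + Complex.I * u) := by
    have := congrArg (starRingEnd ℂ) h
    simpa [← Complex.exp_conj] using this
  have hsq : u' ^ 2 + v' ^ 2 = u ^ 2 + v ^ 2 := by
    have h3 : ((v' : ℂ) - Complex.I * u') * ((v' : ℂ) + Complex.I * u') =
        Complex.exp (θ * Complex.I) * (v - Complex.I * u) *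
          (Complex.exp (-(θ * Complex.I)) * (v + Complex.I * u)) := by rw [h, hconj]
    have h2 : Complex.exp (θ * Complex.I) * Complex.exp (-(θ * Complex.I)) = 1 := by
      rw [← Complex.exp_add]; simp
    have h4 : ((u' ^ 2 + v' ^ 2 : ℝ) : ℂ) = ((u ^ 2 + v ^ 2 : ℝ) : ℂ) := by
      push_cast
      linear_combination h3 + ((v : ℂ) - Complex.I * u) * (v + Complex.I * u) * h2
        + ((u' : ℂ) ^ 2 - u ^ 2) * Complex.I_sq
    exact_mod_cast h4
  induction n generalizing m with
  | zero =>
    induction m with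
    | zero => simp [weylCoeff_zero_zero, hsq]
    | succ m ih =>
      apply mul_left_cancel₀ (sqrt_two_mul_succ_ne_zero m)
      have e : Complex.exp (-(((m + 1 : ℕ) : ℂ) * θ * Complex.I))
          = Complex.exp (-(m * θ * Complex.I)) * Complex.exp (-(θ * Complex.I)) := by
        rw [← Complex.exp_add]; push_cast; ring_nf
      rw [weylCoeff_zero_succ, hconj, ih, e]
      linear_combination (-Complex.exp (((0 : ℕ) : ℂ) * θ * Complex.I) *
        Complex.exp (-(m * θ * Complex.I)) * Complex.exp (-(θ * Complex.I)))
          * weylCoeff_zero_succ u v m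
  | succ n ih =>
    apply mul_left_cancel₀ (sqrt_two_mul_succ_ne_zero n)
    have e : Complex.exp (((n + 1 : ℕ) : ℂ) * θ * Complex.I)
        = Complex.exp (n * θ * Complex.I) * Complex.exp (θ * Complex.I) := by
      rw [← Complex.exp_add]; push_cast; ring_nf
    -- Passing from `m` to `m - 1` costs one phase factor; for `m = 0`, where subtraction truncates,
    -- both sides vanish with the square root.
    have e2 : (Real.sqrt (2 * m) : ℂ) * Complex.exp (-(((m - 1 : ℕ) : ℂ) * θ * Complex.I))
        = (Real.sqrt (2 * m) : ℂ) * (Complex.exp (-(m * θ * Complex.I))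
          * Complex.exp (θ * Complex.I)) := by
      rcases m with _ | m
      · simp
      · rw [← Complex.exp_add]; congr 2; push_cast [Nat.add_sub_cancel]; ring
    rw [weylCoeff_succ_left, h, ih, ih, e]
    have := weylCoeff_succ_left u v n m
    linear_combination (-(Complex.exp (n * θ * Complex.I) *
      Complex.exp (-(m * θ * Complex.I)) * Complex.exp (θ * Complex.I))) * this
      + Complex.exp (n * θ * Complex.I) * weylCoeff u v n (m - 1) * e2

lemma weylCoeff_origin (n m : ℕ) : weylCoeff 0 0 n m = if n = m then 1 else 0 := by
  induction n generalizing m with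
  | zero =>
    rcases m with _ | m
    · simp [weylCoeff_zero_zero]
    · apply mul_left_cancel₀ (sqrt_two_mul_succ_ne_zero m)
      rw [weylCoeff_zero_succ]
      simp
  | succ n ih =>
    apply mul_left_cancel₀ (sqrt_two_mul_succ_ne_zero n)
    rw [weylCoeff_succ_left, ih, ih]
    rcases m with _ | m
    · simp
    · rcases eq_or_ne n m with rfl | hne
      · simp
      · simp [hne]

/-- Orthonormality is the value of the matrix elements at the origin, where the Weyl operator is the
identity. -/
lemma integral_fock_mul (n m : ℕ) : ∫ x : ℝ, fock n x * fock m x = if n = m then 1 else 0 := by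
  have h := weylCoeff_origin n m
  simp only [weylCoeff, weyl] at h
  have : ((∫ x : ℝ, fock n x * fock m x : ℝ) : ℂ) = ((if n = m then 1 else 0 : ℝ) : ℂ) := by
    rw [← integral_complex_ofReal]
    push_cast
    split_ifs at h ⊢ <;> simpa using h
  exact_mod_cast this

/-! ### Gaussian decay of the Hermite functions and of the matrix elements -/

/-- The eigenvalue equation h_n'' = (x² - (2n+1)) h_n of the harmonic oscillator, obtained by
applying one ladder form after the other. -/
lemma hasDerivAt_fock_deriv (n : ℕ) (x : ℝ) :
    HasDerivAt (fun x => x * fock n x - Real.sqrt (2 * (n + 1)) * fock (n + 1) x)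
      ((x ^ 2 - (2 * n + 1)) * fock n x) x := by
  have h1 := (hasDerivAt_id x).mul (hasDerivAt_fock n x)
  have h2 := (hasDerivAt_fock' (n + 1) x).const_mul (Real.sqrt (2 * (n + 1)))
  refine (h1.sub h2).congr_deriv ?_
  have h3 : Real.sqrt (2 * ((n : ℝ) + 1)) * Real.sqrt (2 * (n + 1)) = 2 * (n + 1) :=
    Real.mul_self_sqrt (by positivity)
  push_cast
  simp only [id_eq]
  linear_combination (-fock n x) * h3

lemma integrable_weight_sq (n : ℕ) {τ : ℝ} (hτ : τ < 1) :
    Integrable (fun x : ℝ => Real.exp (τ * x ^ 2) * fock n x ^ 2) := by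
  simpa [sq] using integrable_weighted 1 hτ n n

lemma integrable_sq_weight_sq (n : ℕ) {τ : ℝ} (hτ : τ < 1) :
    Integrable (fun x : ℝ => x ^ 2 * (Real.exp (τ * x ^ 2) * fock n x ^ 2)) := by
  refine (integrable_weighted (Polynomial.X ^ 2) hτ n n).congr (Eventually.of_forall fun x => ?_)
  simp only [Polynomial.eval_pow, Polynomial.eval_X]
  ring

/-- An Agmon-type estimate for the harmonic oscillator. -/
lemma agmon (n : ℕ) {τ : ℝ} (hτ : τ < 1) :
    (1 - τ ^ 2) * ∫ x : ℝ, x ^ 2 * (Real.exp (τ * x ^ 2) * fock n x ^ 2) ≤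
      (2 * n + 1) * ∫ x : ℝ, Real.exp (τ * x ^ 2) * fock n x ^ 2 := by
  set s := Real.sqrt (2 * ((n : ℝ) + 1)) with hs
  have hexp : ∀ x : ℝ, HasDerivAt (fun x : ℝ => Real.exp (τ * x ^ 2))
      (Real.exp (τ * x ^ 2) * (2 * τ * x)) x := fun x => by
    refine (((hasDerivAt_pow 2 x).const_mul τ).exp).congr_deriv ?_
    simp
    ring
  -- The function differentiated is e^{τx²} h_n h_n'. After substituting the eigenvalue equation,
  -- the cross term 2τx h_n h_n' is absorbed by completing the square (h_n' + τx h_n)², which is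
  -- what produces the factor 1 - τ². Integrating and dropping the square gives the claim.
  have hd : ∀ x : ℝ, HasDerivAt
      (fun x => Real.exp (τ * x ^ 2) * (fock n x * (x * fock n x - s * fock (n + 1) x)))
      (Real.exp (τ * x ^ 2) * (x * fock n x - s * fock (n + 1) x + τ * x * fock n x) ^ 2
        + ((1 - τ ^ 2) * (x ^ 2 * (Real.exp (τ * x ^ 2) * fock n x ^ 2))
        - (2 * n + 1) * (Real.exp (τ * x ^ 2) * fock n x ^ 2))) x := fun x => by
    refine ((hexp x).mul ((hasDerivAt_fock n x).mul (hasDerivAt_fock_deriv n x))).congr_deriv ?_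
    simp only [Pi.mul_apply, ← hs]
    ring
  have iX := integrable_weighted Polynomial.X hτ n n
  have i01 := integrable_weighted 1 hτ n (n + 1)
  have i1 : Integrable
      (fun x => Real.exp (τ * x ^ 2) * (fock n x * (x * fock n x - s * fock (n + 1) x))) := by
    refine (iX.sub (i01.const_mul s)).congr (Eventually.of_forall fun x => ?_)
    simp
    ring
  have i2 : Integrable (fun x => Real.exp (τ * x ^ 2) *
      (x * fock n x - s * fock (n + 1) x + τ * x * fock n x) ^ 2) := by
    refine ((((integrable_weighted (Polynomial.X ^ 2) hτ n n).const_mul ((1 + τ) ^ 2)).sub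
      ((integrable_weighted Polynomial.X hτ n (n + 1)).const_mul (2 * (1 + τ) * s))).add
      ((integrable_weighted 1 hτ (n + 1) (n + 1)).const_mul (s ^ 2))).congr
        (Eventually.of_forall fun x => ?_)
    simp
    ring
  have i3 := (integrable_sq_weight_sq n hτ).const_mul (1 - τ ^ 2)
  have i4 := (integrable_weight_sq n hτ).const_mul (2 * n + 1)
  have h0 := integral_eq_zero_of_hasDerivAt_of_integrable hd (i2.add (i3.sub i4)) i1
  rw [integral_add (g := fun x => _ - _) i2 (i3.sub i4), integral_sub i3 i4, integral_const_mul,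
    integral_const_mul] at h0
  have hpos : 0 ≤ ∫ x : ℝ, Real.exp (τ * x ^ 2) *
      (x * fock n x - s * fock (n + 1) x + τ * x * fock n x) ^ 2 :=
    integral_nonneg fun x => by positivity
  linarith

/-- A Jensen-type argument. Write M for the weighted mass and M' for its second moment; the Agmon
estimate gives τM' ≤ aM, with a the exponent on the right. Multiplying the tangent inequality 1 + a
- τx² ≤ e^{a - τx²} by the weighted density and integrating gives (1+a)M - τM' ≤ e^a, since h_n has
norm one. Hence M ≤ e^a. -/
lemma integral_weight_sq_le (n : ℕ) {τ : ℝ} (hτ0 : 0 ≤ τ) (hτ : τ < 1) :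
    ∫ x : ℝ, Real.exp (τ * x ^ 2) * fock n x ^ 2 ≤
      Real.exp ((2 * n + 1) * (τ / (1 - τ ^ 2))) := by
  set M := ∫ x : ℝ, Real.exp (τ * x ^ 2) * fock n x ^ 2 with hM
  set M' := ∫ x : ℝ, x ^ 2 * (Real.exp (τ * x ^ 2) * fock n x ^ 2) with hM'
  set a := (2 * n + 1) * (τ / (1 - τ ^ 2)) with ha
  have h1 : 0 < 1 - τ ^ 2 := by nlinarith
  have hag : (1 - τ ^ 2) * M' ≤ (2 * n + 1) * M := agmon n hτ
  have hag' : τ * M' ≤ a * M := by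
    have : τ * M' = τ / (1 - τ ^ 2) * ((1 - τ ^ 2) * M') := by field_simp
    rw [this, ha]
    calc _ ≤ τ / (1 - τ ^ 2) * ((2 * n + 1) * M) := by gcongr
      _ = _ := by ring
  have hmono : ∫ x : ℝ, ((1 + a) * (Real.exp (τ * x ^ 2) * fock n x ^ 2)
      - τ * (x ^ 2 * (Real.exp (τ * x ^ 2) * fock n x ^ 2)))
      ≤ ∫ x : ℝ, Real.exp a * (fock n x * fock n x) := by
    refine integral_mono (((integrable_weight_sq n hτ).const_mul _).sub
      ((integrable_sq_weight_sq n hτ).const_mul _)) ((integrable_fock_mul n n).const_mul _) ?_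
    intro x
    have h2 : 1 + a - τ * x ^ 2 ≤ Real.exp (a - τ * x ^ 2) := by
      have := Real.add_one_le_exp (a - τ * x ^ 2); linarith
    have h3 : Real.exp (a - τ * x ^ 2) * Real.exp (τ * x ^ 2) = Real.exp a := by
      rw [← Real.exp_add]; ring_nf
    have h4 : (1 + a - τ * x ^ 2) * (Real.exp (τ * x ^ 2) * fock n x ^ 2) ≤
        Real.exp (a - τ * x ^ 2) * (Real.exp (τ * x ^ 2) * fock n x ^ 2) := by gcongr
    simp only
    rw [← mul_assoc (Real.exp _) (Real.exp _), h3] at h4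
    nlinarith
  rw [integral_sub ((integrable_weight_sq n hτ).const_mul _)
    ((integrable_sq_weight_sq n hτ).const_mul _), integral_const_mul, integral_const_mul,
    integral_const_mul, integral_fock_mul, ← hM, ← hM'] at hmono
  simp only [if_true, mul_one] at hmono
  linarith

lemma norm_weylCoeff_le_integral (u v : ℝ) (n m : ℕ) :
    ‖weylCoeff u v n m‖ ≤ ∫ x : ℝ, |fock n x * fock m (x - v)| := by
  refine (norm_integral_le_integral_norm _).trans (le_of_eq ?_)
  congr 1
  ext x
  simp only [weyl, norm_mul, norm_weyl_phase, Complex.norm_real, abs_mul]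
  simp

/-- The Gaussian bound in the position direction, from the Cauchy-Schwarz inequality. -/
lemma integral_abs_fock_mul_shift_le (n m : ℕ) (v : ℝ) {τ : ℝ} (hτ0 : 0 ≤ τ) (hτ : τ < 1) :
    ∫ x : ℝ, |fock n x * fock m (x - v)| ≤
      Real.exp ((n + m + 1) * (τ / (1 - τ ^ 2)) - τ * v ^ 2 / 4) := by
  set κ := τ / (1 - τ ^ 2) with hκ
  -- weighted arithmetic-geometric mean, optimized over the weight
  set c := Real.exp ((m - n) * κ) with hc
  have hcpos : 0 < c := Real.exp_pos _
  have hF := integrable_weight_sq n hτ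
  have hG : Integrable (fun x : ℝ => Real.exp (τ * (x - v) ^ 2) * fock m (x - v) ^ 2) :=
    (integrable_weight_sq m hτ).comp_sub_right v
  have hpt : ∀ x : ℝ, |fock n x * fock m (x - v)| ≤
      Real.exp (-(τ * v ^ 2 / 4)) / 2 * (c * (Real.exp (τ * x ^ 2) * fock n x ^ 2)
        + c⁻¹ * (Real.exp (τ * (x - v) ^ 2) * fock m (x - v) ^ 2)) := by
    intro x
    have e1 : c * c⁻¹ = 1 := mul_inv_cancel₀ hcpos.ne'
    -- Since x² + (x - v)² ≥ v²/2, the two half weights together pay for the Gaussian factor in the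
    -- shift.
    have e2 : Real.exp (τ * v ^ 2 / 4) ≤
        Real.exp (τ * x ^ 2 / 2) * Real.exp (τ * (x - v) ^ 2 / 2) := by
      rw [← Real.exp_add]
      apply Real.exp_le_exp.2
      nlinarith [mul_nonneg hτ0 (sq_nonneg (2 * x - v))]
    have e3 : Real.exp (-(τ * v ^ 2 / 4)) * Real.exp (τ * v ^ 2 / 4) = 1 := by
      rw [← Real.exp_add]; simp
    have e4 : Real.exp (τ * x ^ 2) = Real.exp (τ * x ^ 2 / 2) ^ 2 := by
      rw [← Real.exp_nat_mul]; ring_nf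
    have e5 : Real.exp (τ * (x - v) ^ 2) = Real.exp (τ * (x - v) ^ 2 / 2) ^ 2 := by
      rw [← Real.exp_nat_mul]; ring_nf
    set A := Real.exp (τ * x ^ 2 / 2)
    set A' := Real.exp (τ * (x - v) ^ 2 / 2)
    set E := Real.exp (τ * v ^ 2 / 4)
    have hE' := Real.exp_pos (-(τ * v ^ 2 / 4))
    set E' := Real.exp (-(τ * v ^ 2 / 4))
    rw [abs_mul]
    have e6 : 2 * (A * |fock n x|) * (A' * |fock m (x - v)|) ≤
        c * (A * |fock n x|) ^ 2 + c⁻¹ * (A' * |fock m (x - v)|) ^ 2 := by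
      have : 0 ≤ c * (A * |fock n x| - c⁻¹ * (A' * |fock m (x - v)|)) ^ 2 := by positivity
      have e7 : c * (A * |fock n x| - c⁻¹ * (A' * |fock m (x - v)|)) ^ 2 =
        c * (A * |fock n x|) ^ 2 - 2 * (c * c⁻¹) * (A * |fock n x|) * (A' * |fock m (x - v)|)
          + (c * c⁻¹) * c⁻¹ * (A' * |fock m (x - v)|) ^ 2 := by ring
      rw [e7, e1] at this
      linarith
    calc |fock n x| * |fock m (x - v)|
        = E' * E * (|fock n x| * |fock m (x - v)|) := by rw [e3, one_mul]
      _ ≤ E' * (A * A') * (|fock n x| * |fock m (x - v)|) := by gcongr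
      _ = E' / 2 * (2 * (A * |fock n x|) * (A' * |fock m (x - v)|)) := by ring
      _ ≤ E' / 2 * (c * (A * |fock n x|) ^ 2 + c⁻¹ * (A' * |fock m (x - v)|) ^ 2) := by gcongr
      _ = _ := by rw [e4, e5, mul_pow, mul_pow, sq_abs, sq_abs]
  have hGi : ∫ x : ℝ, Real.exp (τ * (x - v) ^ 2) * fock m (x - v) ^ 2 =
      ∫ x : ℝ, Real.exp (τ * x ^ 2) * fock m x ^ 2 :=
    integral_sub_right_eq_self (fun x : ℝ => Real.exp (τ * x ^ 2) * fock m x ^ 2) v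
  calc ∫ x : ℝ, |fock n x * fock m (x - v)|
      ≤ ∫ x : ℝ, Real.exp (-(τ * v ^ 2 / 4)) / 2 * (c * (Real.exp (τ * x ^ 2) * fock n x ^ 2)
        + c⁻¹ * (Real.exp (τ * (x - v) ^ 2) * fock m (x - v) ^ 2)) :=
        integral_mono (integrable_fock_mul_shift n m v).abs
          (((hF.const_mul c).add (hG.const_mul c⁻¹)).const_mul _) hpt
    _ = Real.exp (-(τ * v ^ 2 / 4)) / 2 * (c * (∫ x : ℝ, Real.exp (τ * x ^ 2) * fock n x ^ 2)
        + c⁻¹ * ∫ x : ℝ, Real.exp (τ * x ^ 2) * fock m x ^ 2) := by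
        rw [integral_const_mul, integral_add (hF.const_mul c) (hG.const_mul c⁻¹),
          integral_const_mul, integral_const_mul, hGi]
    _ ≤ Real.exp (-(τ * v ^ 2 / 4)) / 2 * (c * Real.exp ((2 * n + 1) * κ)
        + c⁻¹ * Real.exp ((2 * m + 1) * κ)) := by
        gcongr
        · exact integral_weight_sq_le n hτ0 hτ
        · exact integral_weight_sq_le m hτ0 hτ
    _ = Real.exp ((n + m + 1) * κ - τ * v ^ 2 / 4) := by
        rw [hc, ← Real.exp_neg, ← Real.exp_add, ← Real.exp_add]
        have a1 : ((m : ℝ) - n) * κ + (2 * n + 1) * κ = (n + m + 1) * κ := by ring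
        have a2 : -(((m : ℝ) - n) * κ) + (2 * m + 1) * κ = (n + m + 1) * κ := by ring
        rw [a1, a2, sub_eq_add_neg, Real.exp_add]
        ring

/-- Rotating by the argument of v - iu moves the point to the position axis. There the oscillating
phase plays no role, and bounding the integrand by its modulus no longer loses the decay in `u`. -/
lemma norm_weylCoeff_eq_rotate (u v : ℝ) (n m : ℕ) :
    ‖weylCoeff u v n m‖ = ‖weylCoeff 0 (Real.sqrt (u ^ 2 + v ^ 2)) n m‖ := by
  set z : ℂ := v - Complex.I * u with hz
  have hnorm : ‖z‖ = Real.sqrt (u ^ 2 + v ^ 2) := by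
    rw [Complex.norm_def, Complex.normSq_apply]
    simp [hz]
    ring_nf
  have h : (v : ℂ) - Complex.I * u =
      Complex.exp (Complex.arg z * Complex.I) *
        ((Real.sqrt (u ^ 2 + v ^ 2) : ℝ) - Complex.I * (0 : ℝ)) := by
    rw [← hnorm, ← hz]
    simp [mul_comm (Complex.exp _)]
  rw [weylCoeff_rotate h n m, norm_mul, norm_mul]
  have e1 : ‖Complex.exp (n * (Complex.arg z : ℂ) * Complex.I)‖ = 1 := by
    have := Complex.norm_exp_ofReal_mul_I (n * Complex.arg z)
    push_cast at this
    exact this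
  have e2 : ‖Complex.exp (-(m * (Complex.arg z : ℂ) * Complex.I))‖ = 1 := by
    have := Complex.norm_exp_ofReal_mul_I (-(m * Complex.arg z))
    push_cast at this
    rw [← this]
    ring_nf
  rw [e1, e2]
  simp

/-- Gaussian decay of the matrix elements of the Weyl operators. -/
lemma norm_weylCoeff_le (u v : ℝ) (n m : ℕ) {τ : ℝ} (hτ0 : 0 ≤ τ) (hτ : τ < 1) :
    ‖weylCoeff u v n m‖ ≤
      Real.exp ((n + m + 1) * (τ / (1 - τ ^ 2)) - τ * (u ^ 2 + v ^ 2) / 4) := by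
  rw [norm_weylCoeff_eq_rotate]
  refine (norm_weylCoeff_le_integral _ _ _ _).trans ?_
  have := integral_abs_fock_mul_shift_le n m (Real.sqrt (u ^ 2 + v ^ 2)) hτ0 hτ
  rwa [Real.sq_sqrt (by positivity)] at this

lemma norm_weylCoeff_le_one (u v : ℝ) (n m : ℕ) : ‖weylCoeff u v n m‖ ≤ 1 := by
  have := norm_weylCoeff_le u v n m le_rfl zero_lt_one
  simpa using this

lemma integral_abs_fock_mul_le (n m : ℕ) : ∫ x : ℝ, |fock n x * fock m x| ≤ 1 := by
  simpa using integral_abs_fock_mul_shift_le n m 0 le_rfl zero_lt_one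

/-! ### Fourier inversion for the matrix elements -/

/-- Fourier inversion with angular frequencies. -/
lemma integral_fourier_inversion {f : ℝ → ℂ} (hc : Continuous f) (hf : Integrable f)
    (hg : Integrable fun u : ℝ => ∫ x : ℝ, Complex.exp (-(Complex.I * ((u * x : ℝ) : ℂ))) * f x)
    (y : ℝ) :
    ∫ u : ℝ, Complex.exp (Complex.I * ((u * y : ℝ) : ℂ)) *
      ∫ x : ℝ, Complex.exp (-(Complex.I * ((u * x : ℝ) : ℂ))) * f x = 2 * Real.pi * f y := by
  set g : ℝ → ℂ := fun u => ∫ x : ℝ, Complex.exp (-(Complex.I * ((u * x : ℝ) : ℂ))) * f x with hgdef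
  have hF : FourierTransform.fourier f = fun w => g (2 * Real.pi * w) := by
    ext w
    rw [Real.fourier_real_eq_integral_exp_smul]
    simp only [hgdef, smul_eq_mul]
    congr 1
    ext x
    congr 2
    push_cast
    ring
  have hpi : (2 * Real.pi) ≠ 0 := by positivity
  have hFi : Integrable (FourierTransform.fourier f) := by
    rw [hF]
    exact hg.comp_mul_left' hpi
  have h := congrFun (hc.fourierInv_fourier_eq hf hFi) y
  rw [hF, Real.fourierInv_eq'] at h
  have h2 : ∀ w : ℝ, Complex.exp (((2 * Real.pi * inner ℝ w y : ℝ) : ℂ) * Complex.I) •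
      g (2 * Real.pi * w) =
      (fun u : ℝ => Complex.exp (Complex.I * ((u * y : ℝ) : ℂ)) * g u) (2 * Real.pi * w) := by
    intro w
    simp only [smul_eq_mul]
    congr 2
    simp
    ring
  rw [integral_congr_ae (Eventually.of_forall h2), Measure.integral_comp_mul_left
    (fun u : ℝ => Complex.exp (Complex.I * ((u * y : ℝ) : ℂ)) * g u)] at h
  change ∫ u : ℝ, Complex.exp (Complex.I * ((u * y : ℝ) : ℂ)) * g u = _
  rw [← h, abs_of_pos (by positivity : 0 < (2 * Real.pi)⁻¹)]
  generalize ∫ u : ℝ, Complex.exp (Complex.I * ((u * y : ℝ) : ℂ)) * g u = J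
  have : (Real.pi : ℂ) ≠ 0 := by exact_mod_cast Real.pi_ne_zero
  rw [Complex.real_smul]
  push_cast
  field_simp

lemma integrable_exp_neg_sq_add_sq {c : ℝ} (hc : 0 < c) :
    Integrable (fun w : ℝ × ℝ => Real.exp (-c * (w.1 ^ 2 + w.2 ^ 2))) := by
  have h := (integrable_exp_neg_mul_sq hc).mul_prod (integrable_exp_neg_mul_sq hc)
  refine h.congr (Eventually.of_forall fun w => ?_)
  simp only [← Real.exp_add]
  ring_nf

lemma exists_norm_weylCoeff_le (n m : ℕ) : ∃ C : ℝ, ∀ u v : ℝ,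
    ‖weylCoeff u v n m‖ ≤ C * Real.exp (-(1 / 8) * (u ^ 2 + v ^ 2)) := by
  refine ⟨Real.exp ((n + m + 1) * ((1 / 2) / (1 - (1 / 2) ^ 2))), fun u v => ?_⟩
  refine (norm_weylCoeff_le u v n m (τ := 1 / 2) (by norm_num) (by norm_num)).trans (le_of_eq ?_)
  rw [← Real.exp_add]
  ring_nf

lemma integrable_weylCoeff_prod (n m : ℕ) :
    Integrable (fun w : ℝ × ℝ => weylCoeff w.1 w.2 n m) := by
  obtain ⟨C, hC⟩ := exists_norm_weylCoeff_le n m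
  exact ((integrable_exp_neg_sq_add_sq (by norm_num : (0 : ℝ) < 1 / 8)).const_mul C).mono'
    (continuous_weylCoeff n m).aestronglyMeasurable (Eventually.of_forall fun w => hC _ _)

lemma continuous_weylCoeff_left (v : ℝ) (n m : ℕ) : Continuous fun u : ℝ => weylCoeff u v n m :=
  Continuous.comp (g := fun w : ℝ × ℝ => weylCoeff w.1 w.2 n m) (f := fun u : ℝ => (u, v))
    (continuous_weylCoeff n m) (by fun_prop)

lemma integrable_weylCoeff_left (v : ℝ) (n m : ℕ) :
    Integrable (fun u : ℝ => weylCoeff u v n m) := by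
  obtain ⟨C, hC⟩ := exists_norm_weylCoeff_le n m
  refine ((integrable_exp_neg_mul_sq (by norm_num : (0 : ℝ) < 1 / 8)).const_mul |C|).mono'
    (continuous_weylCoeff_left v n m).aestronglyMeasurable
    (Eventually.of_forall fun u => (hC u v).trans ?_)
  exact mul_le_mul (le_abs_self C) (Real.exp_le_exp.2 (by nlinarith [sq_nonneg v]))
    (Real.exp_pos _).le (abs_nonneg C)

lemma weylCoeff_eq_fourier (u v : ℝ) (n m : ℕ) :
    weylCoeff u v n m = Complex.exp (Complex.I * ((u * v / 2 : ℝ) : ℂ)) *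
      ∫ x : ℝ, Complex.exp (-(Complex.I * ((u * x : ℝ) : ℂ))) *
        ((fock n x * fock m (x - v) : ℝ) : ℂ) := by
  rw [← integral_const_mul]
  unfold weylCoeff weyl
  congr 1
  ext x
  have : Complex.exp (Complex.I * ((u * v / 2 - u * x : ℝ) : ℂ)) =
      Complex.exp (Complex.I * ((u * v / 2 : ℝ) : ℂ)) *
        Complex.exp (-(Complex.I * ((u * x : ℝ) : ℂ))) := by
    rw [← Complex.exp_add]; push_cast; ring_nf
  rw [this]
  push_cast
  ring

/-- For fixed `v`, the matrix element is, up to a phase, the Fourier transform in `u` of the product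
h_n(x) h_m(x - v). One-dimensional inversion recovers that product. -/
lemma integral_phase_mul_weylCoeff (v y : ℝ) (n m : ℕ) :
    ∫ u : ℝ, Complex.exp (Complex.I * ((u * (y - v / 2) : ℝ) : ℂ)) * weylCoeff u v n m =
      2 * Real.pi * ((fock n y * fock m (y - v) : ℝ) : ℂ) := by
  set f : ℝ → ℂ := fun x => ((fock n x * fock m (x - v) : ℝ) : ℂ) with hf
  have hg : ∀ u : ℝ, ∫ x : ℝ, Complex.exp (-(Complex.I * ((u * x : ℝ) : ℂ))) * f x =
      Complex.exp (-(Complex.I * ((u * v / 2 : ℝ) : ℂ))) * weylCoeff u v n m := by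
    intro u
    rw [weylCoeff_eq_fourier, ← mul_assoc, ← Complex.exp_add]
    simp [hf]
  have hgi : Integrable fun u : ℝ =>
      ∫ x : ℝ, Complex.exp (-(Complex.I * ((u * x : ℝ) : ℂ))) * f x := by
    simp_rw [hg]
    refine (integrable_weylCoeff_left v n m).mono (Continuous.aestronglyMeasurable ?_)
      (Eventually.of_forall fun u => ?_)
    · have := continuous_weylCoeff_left v n m
      fun_prop
    · rw [norm_mul, ← mul_neg, ← Complex.ofReal_neg, mul_comm Complex.I,
        Complex.norm_exp_ofReal_mul_I, one_mul]
  have hcont : Continuous f := by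
    have := continuous_fock n
    have := continuous_fock m
    fun_prop
  have h := integral_fourier_inversion hcont (integrable_fock_mul_shift n m v).ofReal hgi y
  simp_rw [hg] at h
  rw [← h]
  congr 1
  ext u
  rw [← mul_assoc, ← Complex.exp_add]
  push_cast
  ring_nf

/-- The marginals of the phase-space functions are products of Hermite functions. -/
lemma integral_weylCoeff_line (x : ℝ) (n m : ℕ) :
    ∫ t : ℝ, weylCoeff (-2 * t) (2 * x) n m =
      Real.pi * (-1) ^ m * ((fock n x * fock m x : ℝ) : ℂ) := by
  have h := integral_phase_mul_weylCoeff (2 * x) x n m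
  simp only [mul_div_cancel_left₀ x (two_ne_zero' ℝ), sub_self, mul_zero, Complex.ofReal_zero,
    Complex.exp_zero, one_mul] at h
  rw [Measure.integral_comp_mul_left (fun u => weylCoeff u (2 * x) n m), h,
    show x - 2 * x = -x by ring, fock_neg]
  rw [Complex.real_smul]
  norm_num
  ring

/-- The inverse Fourier transform of a matrix element of the Weyl operators is a matrix element
of the displaced parity operator. -/
lemma integral_phase_mul_weylCoeff_prod (q p : ℝ) (n m : ℕ) :
    ∫ w : ℝ × ℝ, Complex.exp (Complex.I * ((w.1 * q + w.2 * p : ℝ) : ℂ)) * weylCoeff w.1 w.2 n m =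
      4 * Real.pi * (-1) ^ m * weylCoeff (-2 * p) (2 * q) n m := by
  have hint : Integrable fun w : ℝ × ℝ =>
      Complex.exp (Complex.I * ((w.1 * q + w.2 * p : ℝ) : ℂ)) * weylCoeff w.1 w.2 n m := by
    refine (integrable_weylCoeff_prod n m).mono (Continuous.aestronglyMeasurable ?_)
      (Eventually.of_forall fun w => ?_)
    · have := continuous_weylCoeff n m
      fun_prop
    · rw [norm_mul, mul_comm Complex.I, Complex.norm_exp_ofReal_mul_I, one_mul]
  rw [Measure.volume_eq_prod] at hint ⊢
  rw [integral_prod_symm _ hint]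
  set F : ℝ → ℂ := fun v => 2 * Real.pi * (Complex.exp (Complex.I * ((v * p : ℝ) : ℂ)) *
    ((fock n (q + v / 2) * fock m (q - v / 2) : ℝ) : ℂ)) with hF
  have h1 : ∀ v : ℝ, ∫ u : ℝ, Complex.exp (Complex.I * ((u * q + v * p : ℝ) : ℂ)) *
      weylCoeff u v n m = F v := by
    intro v
    have h := integral_phase_mul_weylCoeff v (q + v / 2) n m
    have e : ∀ u : ℝ, Complex.exp (Complex.I * ((u * q + v * p : ℝ) : ℂ)) * weylCoeff u v n m =
        Complex.exp (Complex.I * ((v * p : ℝ) : ℂ)) *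
        (Complex.exp (Complex.I * ((u * (q + v / 2 - v / 2) : ℝ) : ℂ)) * weylCoeff u v n m) := by
      intro u
      rw [← mul_assoc, ← Complex.exp_add]
      push_cast
      ring_nf
    simp_rw [e]
    rw [integral_const_mul, h, hF, show q + v / 2 - v = q - v / 2 by ring]
    ring
  simp_rw [h1]
  -- The substitution v = 2(x - q) places the two Hermite functions at x and 2q - x. The parity of
  -- h_m then turns the second into h_m(x - 2q), at the cost of the sign (-1)^m.
  have h2 : ∫ x : ℝ, F (2 * (x - q)) = 2⁻¹ * ∫ v : ℝ, F v := by
    rw [integral_sub_right_eq_self (fun x => F (2 * x)) q, Measure.integral_comp_mul_left]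
    rw [Complex.real_smul]
    norm_num
  have h3 : ∀ x : ℝ, F (2 * (x - q)) = 2 * Real.pi * (-1) ^ m *
      ((fock n x : ℂ) * weyl (-2 * p) (2 * q) (fun y => (fock m y : ℂ)) x) := by
    intro x
    simp only [hF, weyl]
    have e1 : q + 2 * (x - q) / 2 = x := by ring
    have e2 : q - 2 * (x - q) / 2 = -(x - 2 * q) := by ring
    have e3 : 2 * (x - q) * p = -2 * p * (2 * q) / 2 - -2 * p * x := by ring
    rw [e1, e2, e3, fock_neg]
    push_cast
    ring
  simp_rw [h3] at h2
  rw [integral_const_mul] at h2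
  change 2 * Real.pi * (-1) ^ m * weylCoeff (-2 * p) (2 * q) n m = _ at h2
  linear_combination (-2 : ℂ) * h2

/-! ### Stretched exponentials -/

/-- With z = c y^s, a single term z^j/j! ≤ e^z of the exponential series suffices once js ≥ k. The
region y ≤ 1 is absorbed in the constant. -/
lemma exists_exp_neg_rpow_mul_le {c s : ℝ} (hc : 0 < c) (hs : 0 < s) (k : ℕ) :
    ∃ C : ℝ, 0 < C ∧ ∀ y : ℝ, 0 ≤ y → Real.exp (-c * y ^ s) ≤ C / (1 + y) ^ k := by
  obtain ⟨j, hj⟩ := exists_nat_ge (k / s)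
  refine ⟨2 ^ k * (1 + (j.factorial : ℝ) * (c ^ j)⁻¹), by positivity, fun y hy => ?_⟩
  have hz : 0 ≤ c * y ^ s := by positivity
  have h1 : (c * y ^ s) ^ j ≤ (j.factorial : ℝ) * Real.exp (c * y ^ s) := by
    have := Real.pow_div_factorial_le_exp (c * y ^ s) hz j
    rw [div_le_iff₀ (by positivity)] at this
    linarith
  have h2 : (1 : ℝ) ≤ Real.exp (c * y ^ s) := Real.one_le_exp hz
  have h3 : (1 + y) ^ k ≤ 2 ^ k * (1 + (j.factorial : ℝ) * (c ^ j)⁻¹) * Real.exp (c * y ^ s) := by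
    rcases le_total y 1 with h | h
    · calc (1 + y) ^ k ≤ 2 ^ k := by gcongr; linarith
        _ ≤ 2 ^ k * ((1 + (j.factorial : ℝ) * (c ^ j)⁻¹) * Real.exp (c * y ^ s)) := by
          refine le_mul_of_one_le_right (by positivity) (one_le_mul_of_one_le_of_one_le ?_ h2)
          have : 0 ≤ (j.factorial : ℝ) * (c ^ j)⁻¹ := by positivity
          linarith
        _ = _ := by ring
    · have h4 : y ^ k ≤ (y ^ s) ^ j := by
        rw [← Real.rpow_natCast, ← Real.rpow_natCast, ← Real.rpow_mul hy]
        refine Real.rpow_le_rpow_of_exponent_le h ?_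
        rw [div_le_iff₀ hs] at hj
        linarith
      have h5 : (y ^ s) ^ j ≤ (j.factorial : ℝ) * (c ^ j)⁻¹ * Real.exp (c * y ^ s) := by
        rw [mul_pow] at h1
        have : (y ^ s) ^ j = (c ^ j)⁻¹ * (c ^ j * (y ^ s) ^ j) := by
          rw [inv_mul_cancel_left₀ (by positivity)]
        rw [this]
        calc _ ≤ (c ^ j)⁻¹ * ((j.factorial : ℝ) * Real.exp (c * y ^ s)) := by gcongr
          _ = _ := by ring
      calc (1 + y) ^ k ≤ (2 * y) ^ k := by gcongr; linarith
        _ = 2 ^ k * y ^ k := mul_pow _ _ _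
        _ ≤ 2 ^ k * ((j.factorial : ℝ) * (c ^ j)⁻¹ * Real.exp (c * y ^ s)) := by
          gcongr; exact h4.trans h5
        _ ≤ 2 ^ k * (1 + (j.factorial : ℝ) * (c ^ j)⁻¹) * Real.exp (c * y ^ s) := by
          have : 0 ≤ 2 ^ k * Real.exp (c * y ^ s) := by positivity
          nlinarith
  rw [neg_mul, Real.exp_neg, le_div_iff₀ (by positivity), inv_mul_le_iff₀ (Real.exp_pos _)]
  linarith

/-- The weights `e^{-ε (m+n)^s}`. -/
def matrixWeight (ε s : ℝ) (k : ℕ × ℕ) : ℝ := Real.exp (-ε * ((k.1 : ℝ) + (k.2 : ℝ)) ^ s)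

/-- The weights `e^{-b (‖w‖/2)^{2s}}` on the phase space. -/
def phaseWeight (b s : ℝ) (w : ℝ × ℝ) : ℝ := Real.exp (-b * ((w.1 ^ 2 + w.2 ^ 2) / 4) ^ s)

lemma matrixWeight_pos (ε s : ℝ) (k : ℕ × ℕ) : 0 < matrixWeight ε s k := Real.exp_pos _

lemma phaseWeight_pos (b s : ℝ) (w : ℝ × ℝ) : 0 < phaseWeight b s w := Real.exp_pos _

lemma continuous_phaseWeight (b : ℝ) {s : ℝ} (hs : 0 < s) : Continuous (phaseWeight b s) := by
  unfold phaseWeight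
  exact (continuous_const.mul ((by fun_prop : Continuous fun w : ℝ × ℝ =>
    (w.1 ^ 2 + w.2 ^ 2) / 4).rpow_const fun _ => Or.inr hs.le)).rexp

lemma phaseWeight_add (a b s : ℝ) (w : ℝ × ℝ) :
    phaseWeight (a + b) s w = phaseWeight a s w * phaseWeight b s w := by
  unfold phaseWeight
  rw [← Real.exp_add]
  ring_nf

lemma phaseWeight_le_one {b : ℝ} (hb : 0 ≤ b) (s : ℝ) (w : ℝ × ℝ) : phaseWeight b s w ≤ 1 := by
  unfold phaseWeight
  rw [Real.exp_le_one_iff, neg_mul, neg_nonpos]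
  positivity

lemma summable_matrixWeight {ε s : ℝ} (hε : 0 < ε) (hs : 0 < s) :
    Summable (matrixWeight ε s) := by
  obtain ⟨C, hC, h⟩ := exists_exp_neg_rpow_mul_le hε hs 4
  have h1 : Summable fun n : ℕ => 1 / ((n : ℝ) + 1) ^ 2 := by
    simpa using (summable_nat_add_iff 1).2 (Real.summable_one_div_nat_pow.2 (by norm_num : 1 < 2))
  have h2 := (h1.mul_of_nonneg h1 (fun _ => by positivity) (fun _ => by positivity)).mul_left C
  refine Summable.of_nonneg_of_le (fun k => (matrixWeight_pos ε s k).le) (fun k => ?_) h2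
  refine (h _ (by positivity)).trans ?_
  have h3 : (((k.1 : ℝ) + 1) ^ 2 * ((k.2 : ℝ) + 1) ^ 2) ≤ (1 + ((k.1 : ℝ) + k.2)) ^ 4 := by
    have a1 : (0 : ℝ) ≤ k.1 := k.1.cast_nonneg
    have a2 : (0 : ℝ) ≤ k.2 := k.2.cast_nonneg
    calc (((k.1 : ℝ) + 1) ^ 2 * ((k.2 : ℝ) + 1) ^ 2)
        ≤ (1 + ((k.1 : ℝ) + k.2)) ^ 2 * (1 + ((k.1 : ℝ) + k.2)) ^ 2 :=
          mul_le_mul (pow_le_pow_left₀ (by positivity) (by linarith) 2)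
            (pow_le_pow_left₀ (by positivity) (by linarith) 2) (by positivity) (by positivity)
      _ = _ := by ring
  calc C / (1 + ((k.1 : ℝ) + k.2)) ^ 4 ≤ C / (((k.1 : ℝ) + 1) ^ 2 * ((k.2 : ℝ) + 1) ^ 2) := by
        gcongr
    _ = _ := by field_simp

lemma exists_phaseWeight_le {b s : ℝ} (hb : 0 < b) (hs : 0 < s) :
    ∃ C : ℝ, 0 < C ∧ ∀ w : ℝ × ℝ, phaseWeight b s w ≤
      C * ((1 + w.1 ^ 2)⁻¹ * (1 + w.2 ^ 2)⁻¹) := by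
  obtain ⟨C, hC, h⟩ := exists_exp_neg_rpow_mul_le hb hs 2
  refine ⟨16 * C, by positivity, fun w => (h _ (by positivity)).trans ?_⟩
  have h3 : ((1 + w.1 ^ 2) * (1 + w.2 ^ 2)) / 16 ≤ (1 + (w.1 ^ 2 + w.2 ^ 2) / 4) ^ 2 := by
    nlinarith [sq_nonneg w.1, sq_nonneg w.2, mul_nonneg (sq_nonneg w.1) (sq_nonneg w.2),
      sq_nonneg (w.1 ^ 2 - w.2 ^ 2)]
  calc C / (1 + (w.1 ^ 2 + w.2 ^ 2) / 4) ^ 2 ≤ C / (((1 + w.1 ^ 2) * (1 + w.2 ^ 2)) / 16) := by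
        gcongr
    _ = _ := by field_simp

lemma integrable_phaseWeight {b s : ℝ} (hb : 0 < b) (hs : 0 < s) :
    Integrable (phaseWeight b s) := by
  obtain ⟨C, hC, h⟩ := exists_phaseWeight_le hb hs
  refine ((integrable_inv_one_add_sq.mul_prod integrable_inv_one_add_sq).const_mul C).mono'
    (continuous_phaseWeight b hs).aestronglyMeasurable (Eventually.of_forall fun w => ?_)
  rw [Real.norm_eq_abs, abs_of_pos (phaseWeight_pos b s w)]
  exact h w

lemma exists_phaseWeight_line_le {b s : ℝ} (hb : 0 < b) (hs : 0 < s) :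
    ∃ C : ℝ, 0 < C ∧ ∀ w : ℝ × ℝ, phaseWeight b s w ≤ C * (1 + w.1 ^ 2)⁻¹ := by
  obtain ⟨C, hC, h⟩ := exists_phaseWeight_le hb hs
  refine ⟨C, hC, fun w => (h w).trans ?_⟩
  have : (1 + w.2 ^ 2)⁻¹ ≤ 1 := inv_le_one_of_one_le₀ (by nlinarith [sq_nonneg w.2])
  have h2 : 0 < (1 + w.1 ^ 2)⁻¹ := by positivity
  nlinarith [mul_le_mul_of_nonneg_left this h2.le]

/-- A power below one is eventually smaller than any linear function; the constant covers the
remaining bounded range. -/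
lemma exists_rpow_le_linear {s c : ℝ} (hs : s < 1) (hs0 : 0 ≤ s) (hc : 0 < c) (b : ℝ) (hb : 0 < b) :
    ∃ K : ℝ, ∀ x : ℝ, 0 ≤ x → b * x ^ s ≤ c * x + K := by
  have h := (tendsto_rpow_neg_atTop (sub_pos.2 hs)).eventually_le_const (div_pos hc hb)
  obtain ⟨A, hA⟩ := (h.and (eventually_gt_atTop (0 : ℝ))).exists_forall_of_atTop
  refine ⟨b * |A| ^ s, fun x hx => ?_⟩
  rcases le_total A x with hAx | hAx
  · obtain ⟨h1, hx0⟩ := hA x hAx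
    rw [le_div_iff₀ hb] at h1
    have h2 : x ^ s = x ^ (-(1 - s)) * x := by
      rw [← Real.rpow_add_one hx0.ne']
      ring_nf
    have : 0 ≤ b * |A| ^ s := by positivity
    have h3 := mul_le_mul_of_nonneg_right h1 hx
    rw [h2]
    linarith
  · have h1 : x ^ s ≤ |A| ^ s := Real.rpow_le_rpow hx (hAx.trans (le_abs_self A)) hs0
    have h2 : b * x ^ s ≤ b * |A| ^ s := by gcongr
    have : 0 ≤ c * x := by positivity
    linarith

/-! ### Decay of the density matrix combined with decay of the Weyl matrix elements -/

/-- The product of the decay `e^{-B (m+n)^{r/2}}` of the density matrix and of the matrix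
elements of the Weyl operators. -/
def DecayPair (B s b ε C : ℝ) : Prop :=
  0 < ε ∧ 0 < C ∧ ∀ (m n : ℕ) (u v : ℝ),
    Real.exp (-B * ((m : ℝ) + (n : ℝ)) ^ s) * ‖weylCoeff u v n m‖ ≤
      C * (matrixWeight ε s (m, n) * phaseWeight b s (u, v))

/-- Take τ = b in the Gaussian bound: its growth rate in m + n is κ = b/(1-b²), and b < B(1-b) <
B(1-b²) gives κ < B. What remains is the decay rate ε = B - κ in m + n, and C = e^κ comes from the
extra 1 in n + m + 1. -/
lemma exists_decayPair_one {B b : ℝ} (hb : 0 < b) (hbB : b < B / (1 + B)) (hB : 0 < B) :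
    ∃ ε C, DecayPair B 1 b ε C := by
  have hb1 : b < 1 := hbB.trans (by rw [div_lt_one (by linarith)]; linarith)
  set κ := b / (1 - b ^ 2) with hκ
  have h1 : 0 < 1 - b ^ 2 := by nlinarith
  have hκB : κ < B := by
    rw [hκ, div_lt_iff₀ h1]
    rw [lt_div_iff₀ (by linarith)] at hbB
    have : 0 < b * B * (1 - b) := mul_pos (mul_pos hb hB) (by linarith)
    nlinarith
  refine ⟨B - κ, Real.exp κ, by linarith, Real.exp_pos _, fun m n u v => ?_⟩
  have h := norm_weylCoeff_le u v n m hb.le hb1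
  refine (mul_le_mul_of_nonneg_left h (Real.exp_pos _).le).trans (le_of_eq ?_)
  simp only [matrixWeight, phaseWeight, Real.rpow_one, ← Real.exp_add]
  congr 1
  rw [← hκ]
  ring

/-- Write N = m + n and X = (u²+v²)/4. If N ≥ (1-δ)X, the density matrix alone is small enough,
since δ is chosen so that (B-ε)(1-δ) = b. If N ≤ (1-δ)X, the Gaussian bound leaves a linear gain cX,
which beats bX^s because s < 1. This is why any b < B is allowed here. -/
lemma exists_decayPair_lt_one {B b s : ℝ} (hs : 0 < s) (hs1 : s < 1) (hb : 0 < b) (hbB : b < B) :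
    ∃ ε C, DecayPair B s b ε C := by
  set ε := (B - b) / 2 with hε
  have hε0 : 0 < ε := by rw [hε]; linarith
  have hBε : b < B - ε := by rw [hε]; linarith
  set δ := 1 - b / (B - ε) with hδ
  have hδ1 : δ < 1 := by
    have : 0 < b / (B - ε) := div_pos hb (by linarith)
    linarith
  have hδ0 : 0 < δ := by
    have : b / (B - ε) < 1 := (div_lt_one (by linarith)).2 hBε
    linarith
  have hδB : (B - ε) * (1 - δ) = b := by
    rw [hδ]
    have : B - ε ≠ 0 := by linarith
    field_simp
    ring
  -- The gain `c` below is positive as soon as τ² < δ; half of δ is a convenient choice that also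
  -- keeps τ < 1.
  set τ := δ / 2 with hτ
  have hτ0 : 0 < τ := by rw [hτ]; linarith
  have hτ1 : τ < 1 := by rw [hτ]; linarith
  have hτsq : 0 < 1 - τ ^ 2 := by nlinarith
  set κ := τ / (1 - τ ^ 2) with hκ
  have hκ0 : 0 < κ := div_pos hτ0 hτsq
  set c := τ - κ * (1 - δ) with hc
  have hc0 : 0 < c := by
    have : κ * (1 - δ) < τ := by
      rw [hκ, div_mul_eq_mul_div, div_lt_iff₀ hτsq]
      refine mul_lt_mul_of_pos_left ?_ hτ0
      rw [hτ]
      nlinarith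
    linarith
  obtain ⟨K, hK⟩ := exists_rpow_le_linear hs1 hs.le hc0 b hb
  refine ⟨ε, Real.exp (κ + |K|), hε0, Real.exp_pos _, fun m n u v => ?_⟩
  set N : ℝ := (m : ℝ) + n with hN
  set X : ℝ := (u ^ 2 + v ^ 2) / 4 with hX
  have hN0 : 0 ≤ N := by positivity
  have hX0 : 0 ≤ X := by positivity
  have hNs : 0 ≤ N ^ s := by positivity
  simp only [matrixWeight, phaseWeight, ← hN, ← hX]
  rcases le_total ((1 - δ) * X) N with h | h
  · have h1 : (1 - δ) * X ^ s ≤ N ^ s := by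
      calc (1 - δ) * X ^ s ≤ (1 - δ) ^ s * X ^ s := by
            gcongr
            exact Real.self_le_rpow_of_le_one (by linarith) (by linarith) hs1.le
        _ = ((1 - δ) * X) ^ s := by rw [Real.mul_rpow (by linarith) hX0]
        _ ≤ N ^ s := Real.rpow_le_rpow (mul_nonneg (by linarith) hX0) h hs.le
    have h2 : b * X ^ s ≤ (B - ε) * N ^ s := by
      rw [← hδB, mul_assoc]
      have : 0 < B - ε := by linarith
      gcongr
    calc Real.exp (-B * N ^ s) * ‖weylCoeff u v n m‖ ≤ Real.exp (-B * N ^ s) * 1 := by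
          gcongr
          exact norm_weylCoeff_le_one u v n m
      _ ≤ Real.exp (κ + |K|) * (Real.exp (-ε * N ^ s) * Real.exp (-b * X ^ s)) := by
          rw [mul_one, ← Real.exp_add, ← Real.exp_add]
          apply Real.exp_le_exp.2
          have := abs_nonneg K
          linarith
  · calc Real.exp (-B * N ^ s) * ‖weylCoeff u v n m‖
        ≤ Real.exp (-B * N ^ s) *
          Real.exp ((n + m + 1) * κ - τ * (u ^ 2 + v ^ 2) / 4) := by
          gcongr
          exact norm_weylCoeff_le u v n m hτ0.le hτ1
      _ ≤ Real.exp (κ + |K|) * (Real.exp (-ε * N ^ s) * Real.exp (-b * X ^ s)) := by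
          rw [← Real.exp_add, ← Real.exp_add, ← Real.exp_add]
          apply Real.exp_le_exp.2
          have h1 := hK X hX0
          have h2 := le_abs_self K
          have h3 : κ * N ≤ κ * ((1 - δ) * X) := by gcongr
          have h4 : ε * N ^ s ≤ B * N ^ s := by gcongr; linarith
          have h5 : (n + m + 1) * κ - τ * (u ^ 2 + v ^ 2) / 4 = κ * N + κ - τ * X := by
            rw [hN, hX]; ring
          have h6 : c * X = τ * X - κ * ((1 - δ) * X) := by rw [hc]; ring
          linarith

/-! ### Wigner functions of states with decaying density matrices -/

/-- A density matrix with stretched exponential decay, together with the resulting control of the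
terms of `Tr(ρ exp(-iu𝐐 - iv𝐏))`. -/
structure HasDecay (ρ : Matrix ℕ ℕ ℂ) (B s b ε C : ℝ) : Prop where
  posB : 0 < B
  pos_s : 0 < s
  pos_b : 0 < b
  pos_ε : 0 < ε
  posC : 0 < C
  norm_le : ∀ k : ℕ × ℕ, ‖ρ k.1 k.2‖ ≤ matrixWeight B s k
  norm_mul_le : ∀ (k : ℕ × ℕ) (w : ℝ × ℝ),
    ‖ρ k.1 k.2 * weylCoeff w.1 w.2 k.2 k.1‖ ≤ C * (matrixWeight ε s k * phaseWeight b s w)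

lemma DecayPair.hasDecay {B r b ε C : ℝ} (h : DecayPair B (r / 2) b ε C) (hB : 0 < B) (hr : 0 < r)
    (hb : 0 < b) {ρ : Matrix ℕ ℕ ℂ} (hρ : ρ ∈ stateClass B r) : HasDecay ρ B (r / 2) b ε C where
  posB := hB
  pos_s := by positivity
  pos_b := hb
  pos_ε := h.1
  posC := h.2.1
  norm_le k := hρ.2 k.1 k.2
  norm_mul_le k w := by
    rw [norm_mul]
    refine le_trans ?_ (h.2.2 k.1 k.2 w.1 w.2)
    gcongr
    exact hρ.2 k.1 k.2

/-- The phase by which a rotation acts on the matrix elements. -/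
def rotPhase (φ : ℝ) (k : ℕ × ℕ) : ℂ :=
  Complex.exp (k.2 * φ * Complex.I) * Complex.exp (-(k.1 * φ * Complex.I))

lemma norm_rotPhase (φ : ℝ) (k : ℕ × ℕ) : ‖rotPhase φ k‖ = 1 := by
  have e1 := Complex.norm_exp_ofReal_mul_I (k.2 * φ)
  have e2 := Complex.norm_exp_ofReal_mul_I (-(k.1 * φ))
  push_cast at e1 e2
  rw [neg_mul] at e2
  rw [rotPhase, norm_mul, e1, e2, one_mul]

lemma weylCoeff_polar (t φ : ℝ) (k : ℕ × ℕ) :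
    weylCoeff (t * Real.cos φ) (t * Real.sin φ) k.2 k.1 =
      rotPhase φ k * weylCoeff t 0 k.2 k.1 := by
  refine weylCoeff_rotate ?_ _ _
  rw [Complex.exp_mul_I]
  push_cast
  linear_combination ((t : ℂ) * Complex.sin φ) * Complex.I_sq

/-- Reduces the line of angle φ in the Radon transform to the line of angle zero, up to a phase
independent of `t` and `x`. -/
lemma weylCoeff_rotated_point (x t φ : ℝ) (k : ℕ × ℕ) :
    weylCoeff (-2 * (x * Real.sin φ + t * Real.cos φ)) (2 * (x * Real.cos φ - t * Real.sin φ))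
      k.2 k.1 = rotPhase φ k * weylCoeff (-2 * t) (2 * x) k.2 k.1 := by
  refine weylCoeff_rotate ?_ _ _
  rw [Complex.exp_mul_I]
  push_cast
  linear_combination (-(2 * t : ℂ) * Complex.sin φ) * Complex.I_sq

/-- The density `p_ρ(x, φ)` of the quadrature measurements, as a complex number. -/
def quadDensC (ρ : Matrix ℕ ℕ ℂ) (x φ : ℝ) : ℂ :=
  ∑' k : ℕ × ℕ, ρ k.1 k.2 * (rotPhase φ k * ((fock k.2 x * fock k.1 x : ℝ) : ℂ))

/-- The density `p_ρ(x, φ)` of the quadrature measurements. -/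
def quadDens (ρ : Matrix ℕ ℕ ℂ) (x φ : ℝ) : ℝ := (quadDensC ρ x φ).re

namespace HasDecay

variable {ρ : Matrix ℕ ℕ ℂ} {B s b ε C : ℝ}

lemma summable_weight (h : HasDecay ρ B s b ε C) : Summable (matrixWeight ε s) :=
  summable_matrixWeight h.pos_ε h.pos_s

lemma summable_mul_weylCoeff (h : HasDecay ρ B s b ε C) (w : ℝ × ℝ) :
    Summable fun k : ℕ × ℕ => ρ k.1 k.2 * weylCoeff w.1 w.2 k.2 k.1 :=
  Summable.of_norm_bounded ((h.summable_weight.mul_right _).mul_left C) fun k => h.norm_mul_le k w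

lemma wignerFourier_eq (h : HasDecay ρ B s b ε C) (w : ℝ × ℝ) :
    wignerFourier ρ w.1 w.2 = ∑' k : ℕ × ℕ, ρ k.1 k.2 * weylCoeff w.1 w.2 k.2 k.1 :=
  ((h.summable_mul_weylCoeff w).tsum_prod).symm

lemma norm_wignerFourier_le (h : HasDecay ρ B s b ε C) (w : ℝ × ℝ) :
    ‖wignerFourier ρ w.1 w.2‖ ≤ C * (∑' k, matrixWeight ε s k) * phaseWeight b s w := by
  rw [h.wignerFourier_eq, mul_assoc, ← tsum_mul_right, ← tsum_mul_left]
  exact tsum_of_norm_bounded ((h.summable_weight.mul_right _).mul_left C).hasSum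
    fun k => h.norm_mul_le k w

lemma continuous_wignerFourier (h : HasDecay ρ B s b ε C) :
    Continuous fun w : ℝ × ℝ => wignerFourier ρ w.1 w.2 := by
  simp_rw [h.wignerFourier_eq]
  refine continuous_tsum (fun k => continuous_const.mul (continuous_weylCoeff k.2 k.1))
    (h.summable_weight.mul_left C) fun k w => (h.norm_mul_le k w).trans ?_
  have := phaseWeight_le_one h.pos_b.le s w
  have := matrixWeight_pos ε s k
  have := h.posC
  gcongr
  nlinarith

lemma integrable_phase (h : HasDecay ρ B s b ε C) : Integrable (phaseWeight b s) :=
  integrable_phaseWeight h.pos_b h.pos_s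

lemma integrable_wignerFourier (h : HasDecay ρ B s b ε C) :
    Integrable fun w : ℝ × ℝ => wignerFourier ρ w.1 w.2 :=
  (h.integrable_phase.const_mul _).mono' h.continuous_wignerFourier.aestronglyMeasurable
    (Eventually.of_forall h.norm_wignerFourier_le)

lemma norm_phase_mul (x : ℝ) (z : ℂ) : ‖Complex.exp (Complex.I * (x : ℂ)) * z‖ = ‖z‖ := by
  rw [norm_mul, mul_comm Complex.I, Complex.norm_exp_ofReal_mul_I, one_mul]

/-- The Wigner function as the trace of the state against the displaced parity operators. -/
lemma wigner_eq (h : HasDecay ρ B s b ε C) (q p : ℝ) :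
    wigner ρ q p = (1 / Real.pi * ∑' k : ℕ × ℕ, (-1) ^ k.1 *
      (ρ k.1 k.2 * weylCoeff (-2 * p) (2 * q) k.2 k.1) : ℂ).re := by
  set F : ℕ × ℕ → ℝ × ℝ → ℂ := fun k w => Complex.exp (Complex.I * ((w.1 * q + w.2 * p : ℝ) : ℂ)) *
    (ρ k.1 k.2 * weylCoeff w.1 w.2 k.2 k.1) with hF
  have hFn : ∀ k w, ‖F k w‖ ≤ C * (matrixWeight ε s k * phaseWeight b s w) := fun k w => by
    rw [hF, norm_phase_mul]
    exact h.norm_mul_le k w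
  have hFi : ∀ k, Integrable (F k) := fun k => by
    refine ((h.integrable_phase.const_mul _).const_mul C).mono' (Continuous.aestronglyMeasurable ?_)
      (Eventually.of_forall (hFn k))
    have := continuous_weylCoeff k.2 k.1
    fun_prop
  have hFs : Summable fun k => ∫ w, ‖F k w‖ := by
    refine Summable.of_nonneg_of_le (fun k => integral_nonneg fun w => norm_nonneg _)
      (fun k => integral_mono (hFi k).norm ((h.integrable_phase.const_mul _).const_mul C) (hFn k)) ?_
    simp_rw [integral_const_mul]
    exact (h.summable_weight.mul_right _).mul_left C
  have h1 : ∀ w : ℝ × ℝ, Complex.exp (Complex.I * ((w.1 * q + w.2 * p : ℝ) : ℂ)) *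
      wignerFourier ρ w.1 w.2 = ∑' k, F k w := fun w => by
    rw [h.wignerFourier_eq, ← tsum_mul_left]
  have h2 : ∀ k : ℕ × ℕ, ∫ w, F k w = 4 * Real.pi * ((-1) ^ k.1 *
      (ρ k.1 k.2 * weylCoeff (-2 * p) (2 * q) k.2 k.1)) := fun k => by
    have e : ∀ w, F k w = ρ k.1 k.2 * (Complex.exp (Complex.I * ((w.1 * q + w.2 * p : ℝ) : ℂ)) *
      weylCoeff w.1 w.2 k.2 k.1) := fun w => by rw [hF]; ring
    simp_rw [e]
    rw [integral_const_mul, integral_phase_mul_weylCoeff_prod]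
    ring
  unfold wigner
  simp_rw [h1]
  rw [← integral_tsum_of_summable_integral_norm hFi hFs]
  simp_rw [h2]
  rw [tsum_mul_left, ← mul_assoc]
  congr 2
  have : (Real.pi : ℂ) ≠ 0 := by exact_mod_cast Real.pi_ne_zero
  field_simp

lemma norm_neg_one_pow_mul (m : ℕ) (z : ℂ) : ‖(-1) ^ m * z‖ = ‖z‖ := by simp

/-- By the displaced parity formula, the series for the Wigner function uses the same Weyl elements
as its Fourier transform, evaluated at (-2p, 2q), so the termwise bound applies again. -/
lemma abs_wigner_le (h : HasDecay ρ B s b ε C) (q p : ℝ) :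
    |wigner ρ q p| ≤ C * (∑' k, matrixWeight ε s k) * phaseWeight b s (-2 * p, 2 * q) := by
  rw [h.wigner_eq]
  refine (Complex.abs_re_le_norm _).trans ?_
  have hpi : ‖(1 / Real.pi : ℂ)‖ ≤ 1 := by
    rw [norm_div, norm_one, Complex.norm_real, Real.norm_eq_abs, abs_of_pos Real.pi_pos,
      div_le_one Real.pi_pos]
    linarith [Real.pi_gt_three]
  rw [norm_mul]
  refine (mul_le_of_le_one_left (norm_nonneg _) hpi).trans ?_
  rw [mul_assoc, ← tsum_mul_right, ← tsum_mul_left]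
  refine tsum_of_norm_bounded ((h.summable_weight.mul_right _).mul_left C).hasSum fun k => ?_
  rw [norm_neg_one_pow_mul]
  exact h.norm_mul_le k (-2 * p, 2 * q)

lemma continuous_wigner (h : HasDecay ρ B s b ε C) :
    Continuous fun z : ℝ × ℝ => wigner ρ z.1 z.2 := by
  simp_rw [h.wigner_eq]
  refine Complex.continuous_re.comp (continuous_const.mul (continuous_tsum (fun k => ?_)
    (h.summable_weight.mul_left C) fun k z => ?_))
  · exact continuous_const.mul (continuous_const.mul (Continuous.comp
      (g := fun w : ℝ × ℝ => weylCoeff w.1 w.2 k.2 k.1)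
      (f := fun z : ℝ × ℝ => (-2 * z.2, 2 * z.1)) (continuous_weylCoeff k.2 k.1) (by fun_prop)))
  · rw [norm_neg_one_pow_mul]
    refine (h.norm_mul_le k (-2 * z.2, 2 * z.1)).trans ?_
    have := phaseWeight_le_one h.pos_b.le s (-2 * z.2, 2 * z.1)
    have := matrixWeight_pos ε s k
    have := h.posC
    gcongr
    nlinarith

/-! ### Marginals along lines, the Radon transform and the quadrature densities -/

/-- A dominating function on lines of the phase space. -/
lemma exists_line_bound (h : HasDecay ρ B s b ε C) : ∃ C' : ℝ, 0 < C' ∧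
    ∀ (k : ℕ × ℕ) (t x : ℝ), ‖ρ k.1 k.2 * weylCoeff (-2 * t) (2 * x) k.2 k.1‖ ≤
      C' * matrixWeight ε s k * (1 + t ^ 2)⁻¹ := by
  obtain ⟨C1, hC1, h1⟩ := exists_phaseWeight_line_le h.pos_b h.pos_s
  refine ⟨C * C1, mul_pos h.posC hC1, fun k t x => (h.norm_mul_le k (-2 * t, 2 * x)).trans ?_⟩
  have h2 : phaseWeight b s (-2 * t, 2 * x) ≤ C1 * (1 + t ^ 2)⁻¹ := by
    refine (h1 _).trans ?_
    exact mul_le_mul_of_nonneg_left (inv_anti₀ (by positivity)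
      (by simp only; nlinarith [sq_nonneg t])) hC1.le
  have := matrixWeight_pos ε s k
  have := h.posC
  calc C * (matrixWeight ε s k * phaseWeight b s (-2 * t, 2 * x))
      ≤ C * (matrixWeight ε s k * (C1 * (1 + t ^ 2)⁻¹)) := by gcongr
    _ = _ := by ring

lemma integrable_line (h : HasDecay ρ B s b ε C) (k : ℕ × ℕ) (x : ℝ) :
    Integrable fun t : ℝ => ρ k.1 k.2 * weylCoeff (-2 * t) (2 * x) k.2 k.1 := by
  obtain ⟨C', hC', hb⟩ := h.exists_line_bound
  refine (integrable_inv_one_add_sq.const_mul _).mono' (Continuous.aestronglyMeasurable ?_)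
    (Eventually.of_forall fun t => hb k t x)
  exact continuous_const.mul (Continuous.comp
      (g := fun w : ℝ × ℝ => weylCoeff w.1 w.2 k.2 k.1)
      (f := fun t : ℝ => (-2 * t, 2 * x)) (continuous_weylCoeff k.2 k.1) (by fun_prop))

lemma integral_line (k : ℕ × ℕ) (x : ℝ) :
    ∫ t : ℝ, (-1) ^ k.1 * (ρ k.1 k.2 * weylCoeff (-2 * t) (2 * x) k.2 k.1) =
      Real.pi * (ρ k.1 k.2 * ((fock k.2 x * fock k.1 x : ℝ) : ℂ)) := by
  rw [integral_const_mul, integral_const_mul, integral_weylCoeff_line]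
  have : ((-1 : ℂ) ^ k.1) * (-1) ^ k.1 = 1 := by rw [← mul_pow]; simp
  linear_combination (Real.pi * ρ k.1 k.2 * ((fock k.2 x * fock k.1 x : ℝ) : ℂ)) * this

/-- The product of Hermite functions is a line integral of a Weyl element, so the dominating
function on lines gives a bound uniform in x and no sup-norm estimate of Hermite functions is
needed. The integral of 1/(1+t²) is π, which cancels. -/
lemma exists_norm_mul_fock_le (h : HasDecay ρ B s b ε C) : ∃ C' : ℝ, 0 < C' ∧
    ∀ (k : ℕ × ℕ) (x : ℝ), ‖ρ k.1 k.2 * ((fock k.2 x * fock k.1 x : ℝ) : ℂ)‖ ≤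
      C' * matrixWeight ε s k := by
  obtain ⟨C', hC', hb⟩ := h.exists_line_bound
  refine ⟨C', hC', fun k x => ?_⟩
  have h1 : ‖(Real.pi : ℂ) * (ρ k.1 k.2 * ((fock k.2 x * fock k.1 x : ℝ) : ℂ))‖ ≤
      C' * matrixWeight ε s k * Real.pi := by
    rw [← integral_line, ← integral_univ_inv_one_add_sq, ← integral_const_mul]
    refine norm_integral_le_of_norm_le (integrable_inv_one_add_sq.const_mul _)
      (Eventually.of_forall fun t => ?_)
    rw [norm_neg_one_pow_mul]
    exact hb k t x
  rw [norm_mul, Complex.norm_real, Real.norm_eq_abs, abs_of_pos Real.pi_pos, mul_comm] at h1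
  exact le_of_mul_le_mul_right h1 Real.pi_pos

lemma exists_norm_quad_le (h : HasDecay ρ B s b ε C) : ∃ C' : ℝ, 0 < C' ∧
    ∀ (k : ℕ × ℕ) (x φ : ℝ),
      ‖ρ k.1 k.2 * (rotPhase φ k * ((fock k.2 x * fock k.1 x : ℝ) : ℂ))‖ ≤
      C' * matrixWeight ε s k := by
  obtain ⟨C', hC', hb⟩ := h.exists_norm_mul_fock_le
  refine ⟨C', hC', fun k x φ => le_trans (le_of_eq ?_) (hb k x)⟩
  rw [norm_mul, norm_mul, norm_rotPhase, one_mul, norm_mul]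

lemma summable_quad (h : HasDecay ρ B s b ε C) (x φ : ℝ) :
    Summable fun k : ℕ × ℕ => ρ k.1 k.2 * (rotPhase φ k * ((fock k.2 x * fock k.1 x : ℝ) : ℂ)) := by
  obtain ⟨C', hC', hb⟩ := h.exists_norm_quad_le
  exact Summable.of_norm_bounded (h.summable_weight.mul_left C') fun k => hb k x φ

lemma continuous_quadDensC (h : HasDecay ρ B s b ε C) :
    Continuous fun z : ℝ × ℝ => quadDensC ρ z.1 z.2 := by
  obtain ⟨C', hC', hb⟩ := h.exists_norm_quad_le
  unfold quadDensC
  refine continuous_tsum (fun k => ?_) (h.summable_weight.mul_left C') fun k z => hb k z.1 z.2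
  have := continuous_fock k.1
  have := continuous_fock k.2
  unfold rotPhase
  fun_prop

lemma continuous_quadDens (h : HasDecay ρ B s b ε C) :
    Continuous fun z : ℝ × ℝ => quadDens ρ z.1 z.2 :=
  Complex.continuous_re.comp h.continuous_quadDensC

/-- The Radon transform of the Wigner function. -/
lemma radon_wigner (h : HasDecay ρ B s b ε C) (x φ : ℝ) :
    radon (wigner ρ) x φ = quadDens ρ x φ := by
  obtain ⟨C', hC', hb⟩ := h.exists_line_bound
  set F : ℕ × ℕ → ℝ → ℂ := fun k t => rotPhase φ k * ((-1) ^ k.1 *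
    (ρ k.1 k.2 * weylCoeff (-2 * t) (2 * x) k.2 k.1)) with hF
  have hFn : ∀ k t, ‖F k t‖ ≤ C' * matrixWeight ε s k * (1 + t ^ 2)⁻¹ := fun k t => by
    rw [hF, norm_mul, norm_rotPhase, one_mul, norm_neg_one_pow_mul]
    exact hb k t x
  have hFi : ∀ k, Integrable (F k) := fun k => ((h.integrable_line k x).const_mul _).const_mul _
  have hsumw : Summable fun k => C' * matrixWeight ε s k := h.summable_weight.mul_left C'
  have hFs : Summable fun k => ∫ t, ‖F k t‖ := by
    refine Summable.of_nonneg_of_le (fun k => integral_nonneg fun w => norm_nonneg _)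
      (fun k => integral_mono (hFi k).norm (integrable_inv_one_add_sq.const_mul _) (hFn k)) ?_
    simp_rw [integral_const_mul]
    exact hsumw.mul_right _
  have h1 : ∀ t : ℝ, wigner ρ (x * Real.cos φ - t * Real.sin φ) (x * Real.sin φ + t * Real.cos φ)
      = (1 / Real.pi * ∑' k, F k t : ℂ).re := fun t => by
    rw [h.wigner_eq]
    congr 3
    ext k
    rw [weylCoeff_rotated_point, hF]
    ring
  have hint : Integrable fun t => (1 / Real.pi * ∑' k, F k t : ℂ) := by
    refine Integrable.const_mul ?_ _
    refine (integrable_inv_one_add_sq.const_mul (∑' k, C' * matrixWeight ε s k)).mono'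
      (Continuous.aestronglyMeasurable ?_) (Eventually.of_forall fun t => ?_)
    · refine continuous_tsum (fun k => ?_) hsumw fun k t => (hFn k t).trans ?_
      · exact continuous_const.mul (continuous_const.mul (continuous_const.mul (Continuous.comp
          (g := fun w : ℝ × ℝ => weylCoeff w.1 w.2 k.2 k.1)
          (f := fun t : ℝ => (-2 * t, 2 * x)) (continuous_weylCoeff k.2 k.1) (by fun_prop))))
      · refine mul_le_of_le_one_right (mul_pos hC' (matrixWeight_pos ε s k)).le ?_
        exact inv_le_one_of_one_le₀ (by nlinarith [sq_nonneg t])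
    · rw [← tsum_mul_right]
      exact tsum_of_norm_bounded (hsumw.mul_right _).hasSum fun k => hFn k t
  unfold radon quadDens
  simp_rw [h1]
  change ∫ t, Complex.reCLM (1 / Real.pi * ∑' k, F k t : ℂ) = _
  rw [ContinuousLinearMap.integral_comp_comm _ hint, integral_const_mul,
    ← integral_tsum_of_summable_integral_norm hFi hFs, quadDensC, ← tsum_mul_left]
  change Complex.re _ = _
  congr 2
  ext k
  rw [hF]
  simp only
  rw [integral_const_mul, integral_line]
  have : (Real.pi : ℂ) ≠ 0 := by exact_mod_cast Real.pi_ne_zero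
  field_simp

/-- The Fourier slice theorem for the quadrature densities. -/
lemma integral_phase_mul_quadDensC (h : HasDecay ρ B s b ε C) (t φ : ℝ) :
    ∫ x : ℝ, Complex.exp (-(Complex.I * ((t * x : ℝ) : ℂ))) * quadDensC ρ x φ =
      wignerFourier ρ (t * Real.cos φ) (t * Real.sin φ) := by
  set F : ℕ × ℕ → ℝ → ℂ := fun k x => ρ k.1 k.2 * (rotPhase φ k *
    (Complex.exp (-(Complex.I * ((t * x : ℝ) : ℂ))) * ((fock k.2 x * fock k.1 x : ℝ) : ℂ))) with hF
  have hexp : ∀ x : ℝ, ‖Complex.exp (-(Complex.I * ((t * x : ℝ) : ℂ)))‖ = 1 := fun x => by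
    rw [← mul_neg, ← Complex.ofReal_neg, mul_comm, Complex.norm_exp_ofReal_mul_I]
  have hFn : ∀ k x, ‖F k x‖ = ‖ρ k.1 k.2‖ * |fock k.2 x * fock k.1 x| := fun k x => by
    rw [hF, norm_mul, norm_mul, norm_mul, norm_rotPhase, hexp, Complex.norm_real, one_mul, one_mul,
      Real.norm_eq_abs]
  have hFi : ∀ k, Integrable (F k) := fun k => by
    refine Integrable.const_mul (Integrable.const_mul ?_ _) _
    refine (integrable_fock_mul k.2 k.1).abs.mono' (Continuous.aestronglyMeasurable ?_)
      (Eventually.of_forall fun x => ?_)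
    · have := continuous_fock k.1
      have := continuous_fock k.2
      fun_prop
    · rw [norm_mul, hexp, Complex.norm_real, one_mul, Real.norm_eq_abs]
  have hFs : Summable fun k => ∫ x, ‖F k x‖ := by
    refine Summable.of_nonneg_of_le (fun k => integral_nonneg fun w => norm_nonneg _)
      (fun k => ?_) (summable_matrixWeight h.posB h.pos_s)
    simp_rw [hFn]
    rw [integral_const_mul]
    have h1 := integral_abs_fock_mul_le k.2 k.1
    exact (mul_le_of_le_one_right (norm_nonneg _) h1).trans (h.norm_le k)
  have h1 : ∀ x : ℝ, Complex.exp (-(Complex.I * ((t * x : ℝ) : ℂ))) * quadDensC ρ x φ =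
      ∑' k, F k x := fun x => by
    rw [quadDensC, ← tsum_mul_left]
    congr 1
    ext k
    rw [hF]
    ring
  have h2 : ∀ k : ℕ × ℕ, ∫ x, F k x =
      ρ k.1 k.2 * weylCoeff (t * Real.cos φ) (t * Real.sin φ) k.2 k.1 := fun k => by
    rw [hF, weylCoeff_polar]
    simp only
    rw [integral_const_mul, integral_const_mul, weylCoeff_eq_fourier]
    simp
  simp_rw [h1]
  rw [← integral_tsum_of_summable_integral_norm hFi hFs]
  simp_rw [h2]
  exact (h.wignerFourier_eq (t * Real.cos φ, t * Real.sin φ)).symm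

/-- Each product h_n h_m has L¹ norm at most one, so the double series converges absolutely in L¹ by
the decay of the density matrix itself. -/
lemma integrable_quadDensC (h : HasDecay ρ B s b ε C) (φ : ℝ) :
    Integrable fun x => quadDensC ρ x φ := by
  refine ⟨(Continuous.comp (g := fun z : ℝ × ℝ => quadDensC ρ z.1 z.2)
    (f := fun x : ℝ => (x, φ)) h.continuous_quadDensC (by fun_prop)).aestronglyMeasurable, ?_⟩
  have hterm : ∀ k : ℕ × ℕ, ∫⁻ x : ℝ,
      ‖ρ k.1 k.2 * (rotPhase φ k * ((fock k.2 x * fock k.1 x : ℝ) : ℂ))‖ₑ ≤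
      ENNReal.ofReal (matrixWeight B s k) := fun k => by
    have e : ∀ x : ℝ, ‖ρ k.1 k.2 * (rotPhase φ k * ((fock k.2 x * fock k.1 x : ℝ) : ℂ))‖ₑ =
        ENNReal.ofReal (‖ρ k.1 k.2‖ * |fock k.2 x * fock k.1 x|) := fun x => by
      rw [← ofReal_norm, norm_mul, norm_mul, norm_rotPhase, Complex.norm_real, one_mul,
        Real.norm_eq_abs]
    simp_rw [e]
    rw [← ofReal_integral_eq_lintegral_ofReal ((integrable_fock_mul k.2 k.1).abs.const_mul _)
      (Eventually.of_forall fun x => by positivity), integral_const_mul]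
    apply ENNReal.ofReal_le_ofReal
    exact (mul_le_of_le_one_right (norm_nonneg _) (integral_abs_fock_mul_le k.2 k.1)).trans
      (h.norm_le k)
  have hmeas : ∀ k : ℕ × ℕ, AEMeasurable fun x : ℝ =>
      ‖ρ k.1 k.2 * (rotPhase φ k * ((fock k.2 x * fock k.1 x : ℝ) : ℂ))‖ₑ := fun k => by
    have := continuous_fock k.1
    have := continuous_fock k.2
    exact (Continuous.aestronglyMeasurable (by fun_prop)).enorm
  calc ∫⁻ x, ‖quadDensC ρ x φ‖ₑ
      ≤ ∫⁻ x : ℝ, ∑' k : ℕ × ℕ,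
        ‖ρ k.1 k.2 * (rotPhase φ k * ((fock k.2 x * fock k.1 x : ℝ) : ℂ))‖ₑ :=
        lintegral_mono fun x => enorm_tsum_le_tsum_enorm
    _ = ∑' k : ℕ × ℕ, ∫⁻ x : ℝ,
        ‖ρ k.1 k.2 * (rotPhase φ k * ((fock k.2 x * fock k.1 x : ℝ) : ℂ))‖ₑ :=
        lintegral_tsum hmeas
    _ ≤ ∑' k : ℕ × ℕ, ENNReal.ofReal (matrixWeight B s k) := ENNReal.tsum_le_tsum hterm
    _ = ENNReal.ofReal (∑' k, matrixWeight B s k) :=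
        (ENNReal.ofReal_tsum_of_nonneg (fun k => (matrixWeight_pos B s k).le)
          (summable_matrixWeight h.posB h.pos_s)).symm
    _ < ⊤ := ENNReal.ofReal_lt_top

-- The density is the limit of the quadratic forms of ρ at the truncations of the vector e^{inφ}
-- h_n(x), and these are nonnegative because ρ is positive semidefinite. Hence `ENNReal.ofReal` in
-- `idealLaw` discards nothing.
open scoped ComplexOrder in
lemma quadDensC_nonneg (h : HasDecay ρ B s b ε C) (hρ : IsState ρ) (x φ : ℝ) :
    0 ≤ (quadDensC ρ x φ).re ∧ (quadDensC ρ x φ).im = 0 := by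
  set f : ℕ → ℂ := fun n => Complex.exp (n * φ * Complex.I) * (fock n x : ℂ) with hf
  have hterm : ∀ k : ℕ × ℕ, star (f k.1) * ρ k.1 k.2 * f k.2 =
      ρ k.1 k.2 * (rotPhase φ k * ((fock k.2 x * fock k.1 x : ℝ) : ℂ)) := fun k => by
    have : star (f k.1) = Complex.exp (-(k.1 * φ * Complex.I)) * (fock k.1 x : ℂ) := by
      simp [hf, ← Complex.exp_conj]
    rw [this, hf, rotPhase]
    push_cast
    ring
  set S : ℕ → Finset (ℕ × ℕ) := fun N => Finset.range N ×ˢ Finset.range N with hS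
  have hlim : Tendsto (fun N => ∑ k ∈ S N, star (f k.1) * ρ k.1 k.2 * f k.2) atTop
      (𝓝 (quadDensC ρ x φ)) := by
    have h1 := (h.summable_quad x φ).hasSum
    have h2 : Tendsto S atTop atTop := by
      refine tendsto_atTop_finset_of_monotone (fun a c hac => ?_) fun k => ⟨k.1 + k.2 + 1, ?_⟩
      · exact Finset.product_subset_product (Finset.range_mono hac) (Finset.range_mono hac)
      · simp only [hS, Finset.mem_product, Finset.mem_range]
        omega
    simp_rw [hterm]
    exact h1.comp h2
  have hpos : ∀ N, 0 ≤ ∑ k ∈ S N, star (f k.1) * ρ k.1 k.2 * f k.2 := fun N => by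
    set y : ℕ →₀ ℂ := Finsupp.onFinset (Finset.range N) (fun n => if n < N then f n else 0)
      (fun n hn => by
        by_contra hc
        rw [Finset.mem_range] at hc
        simp [hc] at hn) with hy
    have h1 := hρ.2.1.2 y
    have hsub : y.support ⊆ Finset.range N := Finsupp.support_onFinset_subset
    rw [Finsupp.sum_of_support_subset _ hsub _ (by simp)] at h1
    rw [hS, Finset.sum_product]
    refine h1.trans (le_of_eq (Finset.sum_congr rfl fun i hi => ?_))
    rw [Finsupp.sum_of_support_subset _ hsub _ (by simp)]
    refine Finset.sum_congr rfl fun j hj => ?_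
    rw [Finset.mem_range] at hi hj
    simp [hy, hi, hj]
  constructor
  · exact ge_of_tendsto' ((Complex.continuous_re.tendsto _).comp hlim)
      fun N => (Complex.nonneg_iff.1 (hpos N)).1
  · refine tendsto_nhds_unique ((Complex.continuous_im.tendsto _).comp hlim) ?_
    refine tendsto_const_nhds.congr fun N => ?_
    exact (Complex.nonneg_iff.1 (hpos N)).2

lemma quadDens_nonneg (h : HasDecay ρ B s b ε C) (hρ : IsState ρ) (x φ : ℝ) :
    0 ≤ quadDens ρ x φ := (h.quadDensC_nonneg hρ x φ).1

lemma quadDensC_eq (h : HasDecay ρ B s b ε C) (hρ : IsState ρ) (x φ : ℝ) :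
    quadDensC ρ x φ = (quadDens ρ x φ : ℂ) :=
  Complex.ext (by simp [quadDens]) (by simp [(h.quadDensC_nonneg hρ x φ).2])

lemma integrable_quadDens (h : HasDecay ρ B s b ε C) (φ : ℝ) :
    Integrable fun x => quadDens ρ x φ := (h.integrable_quadDensC φ).re

lemma wignerFourier_zero (hρ : IsState ρ) : wignerFourier ρ 0 0 = 1 := by
  unfold wignerFourier
  simp_rw [weylCoeff_origin]
  refine Eq.trans ?_ hρ.2.2.tsum_eq
  congr 1
  ext m
  simp

/-- The total mass is the Fourier slice at frequency zero, that is, the trace of the state. -/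
lemma integral_quadDens (h : HasDecay ρ B s b ε C) (hρ : IsState ρ) (φ : ℝ) :
    ∫ x, quadDens ρ x φ = 1 := by
  have h1 := h.integral_phase_mul_quadDensC 0 φ
  simp_rw [h.quadDensC_eq hρ] at h1
  simp only [zero_mul, Complex.ofReal_zero, mul_zero, neg_zero, Complex.exp_zero, one_mul,
    wignerFourier_zero hρ] at h1
  rw [integral_complex_ofReal] at h1
  exact_mod_cast h1

end HasDecay

/-! ### The kernel -/

lemma noiseFourier_eq {η : ℝ} (hη : η < 1) (t : ℝ) :
    noiseFourier η t = (Real.exp (-((1 - η) / 4 * t ^ 2)) : ℂ) := by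
  have hv : Real.toNNReal ((1 - η) / 2) ≠ 0 := by
    simp only [ne_eq, Real.toNNReal_eq_zero, not_le]
    linarith
  have hvc : ((Real.toNNReal ((1 - η) / 2) : NNReal) : ℂ) = (((1 - η) / 2 : ℝ) : ℂ) := by
    rw [← Real.coe_toNNReal ((1 - η) / 2) (by linarith)]
    simp
  have h := charFun_gaussianReal (μ := 0) (v := Real.toNNReal ((1 - η) / 2)) (-t)
  rw [charFun_apply_real, integral_gaussianReal_eq_integral_smul hv] at h
  unfold noiseFourier
  refine Eq.trans ?_ (h.trans ?_)
  · congr 1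
    ext x
    rw [Complex.real_smul, mul_comm]
    congr 2
    push_cast
    ring
  · rw [hvc]
    push_cast
    congr 1
    ring

lemma kernel_eq {η γ : ℝ} (hη0 : 0 < η) (hη1 : η < 1) (hγ : γ = (1 - η) / (4 * η)) (h u : ℝ) :
    kernel η h u = (1 / (4 * (Real.pi : ℂ)) * ∫ t in (-(1 / h))..(1 / h),
      Complex.exp (-(Complex.I * (u * t : ℝ))) * ((|t| * Real.exp (γ * t ^ 2) : ℝ) : ℂ)).re := by
  unfold kernel
  congr 3
  ext t
  have e : Real.exp (-((1 - η) / 4 * (t / Real.sqrt η) ^ 2)) = (Real.exp (γ * t ^ 2))⁻¹ := by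
    rw [← Real.exp_neg, div_pow, Real.sq_sqrt hη0.le, hγ]
    congr 1
    field_simp
  rw [noiseFourier_eq hη1, e]
  push_cast
  rw [div_inv_eq_mul, mul_assoc]

lemma integral_abs_mul_exp {γ R : ℝ} (hγ : 0 < γ) (hR : 0 ≤ R) :
    ∫ t in (-R)..R, |t| * Real.exp (γ * t ^ 2) = (Real.exp (γ * R ^ 2) - 1) / γ := by
  have hd : ∀ t : ℝ, HasDerivAt (fun t => Real.exp (γ * t ^ 2) / (2 * γ))
      (t * Real.exp (γ * t ^ 2)) t := fun t => by
    refine ((((hasDerivAt_pow 2 t).const_mul γ).exp).div_const (2 * γ)).congr_deriv ?_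
    field_simp
    norm_num
    ring
  have hc : Continuous fun t : ℝ => t * Real.exp (γ * t ^ 2) := by fun_prop
  have hca : Continuous fun t : ℝ => |t| * Real.exp (γ * t ^ 2) := by fun_prop
  have h1 : ∫ t in (0)..R, |t| * Real.exp (γ * t ^ 2) = (Real.exp (γ * R ^ 2) - 1) / (2 * γ) := by
    rw [← intervalIntegral.integral_congr (f := fun t : ℝ => t * Real.exp (γ * t ^ 2)),
      intervalIntegral.integral_eq_sub_of_hasDerivAt (fun t _ => hd t) (hc.intervalIntegrable _ _)]
    · simp; ring
    · intro t ht
      rw [Set.uIcc_of_le hR] at ht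
      simp only [abs_of_nonneg ht.1]
  have h2 : ∫ t in (-R)..0, |t| * Real.exp (γ * t ^ 2) =
      ∫ t in (0)..R, |t| * Real.exp (γ * t ^ 2) := by
    have := intervalIntegral.integral_comp_neg (a := 0) (b := R)
      (fun t : ℝ => |t| * Real.exp (γ * t ^ 2))
    simp only [abs_neg, neg_sq, neg_zero] at this
    exact this.symm
  rw [← intervalIntegral.integral_add_adjacent_intervals (hca.intervalIntegrable (-R) 0)
    (hca.intervalIntegrable 0 R), h2, h1]
  field_simp
  ring

lemma norm_phase_neg (x : ℝ) : ‖Complex.exp (-(Complex.I * (x : ℂ)))‖ = 1 := by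
  rw [← mul_neg, ← Complex.ofReal_neg, mul_comm, Complex.norm_exp_ofReal_mul_I]

/-- The modulus of the integrand has an explicit primitive, because the factor |t| is, up to a
constant, the derivative of the exponent. This sup bound is the only input to the variance. -/
lemma abs_kernel_le {η γ : ℝ} (hη0 : 0 < η) (hη1 : η < 1) (hγ : γ = (1 - η) / (4 * η)) {h : ℝ}
    (hh : 0 < h) (u : ℝ) : |kernel η h u| ≤ Real.exp (γ / h ^ 2) / γ := by
  have hγ0 : 0 < γ := by rw [hγ]; exact div_pos (by linarith) (by linarith)
  have hR : 0 ≤ 1 / h := by positivity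
  rw [kernel_eq hη0 hη1 hγ]
  refine (Complex.abs_re_le_norm _).trans ?_
  have h1 : ‖∫ t in (-(1 / h))..(1 / h), Complex.exp (-(Complex.I * (u * t : ℝ))) *
      ((|t| * Real.exp (γ * t ^ 2) : ℝ) : ℂ)‖ ≤ (Real.exp (γ * (1 / h) ^ 2) - 1) / γ := by
    rw [← integral_abs_mul_exp hγ0 hR]
    refine intervalIntegral.norm_integral_le_of_norm_le (by linarith)
      (Eventually.of_forall fun t _ => ?_) (Continuous.intervalIntegrable (by fun_prop) _ _)
    rw [norm_mul, norm_phase_neg, one_mul, Complex.norm_real, Real.norm_eq_abs,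
      abs_of_nonneg (by positivity)]
  have hpi : ‖(1 / (4 * Real.pi) : ℂ)‖ ≤ 1 := by
    rw [norm_div, norm_one, norm_mul, Complex.norm_real, Real.norm_eq_abs, abs_of_pos Real.pi_pos,
      Complex.norm_ofNat, div_le_one (by positivity)]
    linarith [Real.pi_gt_three]
  rw [norm_mul]
  refine (mul_le_of_le_one_left (norm_nonneg _) hpi).trans (h1.trans ?_)
  rw [div_pow, one_pow, mul_one_div]
  gcongr
  linarith

lemma continuous_kernel {η γ : ℝ} (hη0 : 0 < η) (hη1 : η < 1) (hγ : γ = (1 - η) / (4 * η))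
    (h : ℝ) : Continuous (kernel η h) := by
  have : kernel η h = fun u => (1 / (4 * (Real.pi : ℂ)) * ∫ t in (-(1 / h))..(1 / h),
      Complex.exp (-(Complex.I * (u * t : ℝ))) * ((|t| * Real.exp (γ * t ^ 2) : ℝ) : ℂ)).re :=
    funext fun u => kernel_eq hη0 hη1 hγ h u
  rw [this]
  refine Complex.continuous_re.comp (continuous_const.mul ?_)
  exact intervalIntegral.continuous_parametric_intervalIntegral_of_continuous'
    (f := fun (u t : ℝ) => Complex.exp (-(Complex.I * (u * t : ℝ))) *
      ((|t| * Real.exp (γ * t ^ 2) : ℝ) : ℂ)) (by simp only [Function.uncurry_def]; fun_prop) _ _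

/-! ### The law of the observations -/

namespace HasDecay

variable {ρ : Matrix ℕ ℕ ℂ} {B s b ε C : ℝ}

lemma integrable_quadDens_prod (h : HasDecay ρ B s b ε C) (hρ : IsState ρ) :
    Integrable (fun z : ℝ × ℝ => quadDens ρ z.1 z.2)
      (volume.prod (volume.restrict (Set.Icc 0 Real.pi))) := by
  rw [integrable_prod_iff' h.continuous_quadDens.aestronglyMeasurable]
  refine ⟨Eventually.of_forall fun φ => h.integrable_quadDens φ, ?_⟩
  have : ∀ φ, ∫ x, ‖quadDens ρ x φ‖ = 1 := fun φ => by
    simp_rw [Real.norm_eq_abs, abs_of_nonneg (h.quadDens_nonneg hρ _ φ)]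
    exact h.integral_quadDens hρ φ
  simp_rw [this]
  exact integrable_const _

lemma idealLaw_eq (h : HasDecay ρ B s b ε C) :
    idealLaw ρ = (ENNReal.ofReal (1 / Real.pi) •
      volume.prod (volume.restrict (Set.Icc 0 Real.pi))).withDensity
      (fun z => ENNReal.ofReal (quadDens ρ z.1 z.2)) := by
  unfold idealLaw
  simp_rw [h.radon_wigner]
  rw [Measure.volume_eq_prod, ← Measure.prod_restrict, Measure.restrict_univ]

lemma measurable_ofReal_quadDens (h : HasDecay ρ B s b ε C) :
    Measurable fun z : ℝ × ℝ => ENNReal.ofReal (quadDens ρ z.1 z.2) :=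
  h.continuous_quadDens.measurable.ennreal_ofReal

lemma isProbabilityMeasure_idealLaw (h : HasDecay ρ B s b ε C) (hρ : IsState ρ) :
    IsProbabilityMeasure (idealLaw ρ) := by
  refine ⟨?_⟩
  rw [h.idealLaw_eq, withDensity_apply _ MeasurableSet.univ, Measure.restrict_univ,
    lintegral_smul_measure, lintegral_prod_symm _ h.measurable_ofReal_quadDens.aemeasurable]
  have : ∀ φ, ∫⁻ x, ENNReal.ofReal (quadDens ρ x φ) = 1 := fun φ => by
    rw [← ofReal_integral_eq_lintegral_ofReal (h.integrable_quadDens φ)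
      (Eventually.of_forall fun x => h.quadDens_nonneg hρ x φ), h.integral_quadDens hρ,
      ENNReal.ofReal_one]
  simp_rw [this]
  simp only [lintegral_const, one_mul, Measure.restrict_apply MeasurableSet.univ, Set.univ_inter,
    Real.volume_Icc, sub_zero, smul_eq_mul]
  rw [← ENNReal.ofReal_mul (by positivity), one_div, inv_mul_cancel₀ Real.pi_ne_zero,
    ENNReal.ofReal_one]

/-- Expectations under the ideal law of bounded functions. -/
lemma integral_idealLaw (h : HasDecay ρ B s b ε C) (hρ : IsState ρ) {g : ℝ × ℝ → ℂ}
    (hg : Continuous g) {M : ℝ} (hM : ∀ z, ‖g z‖ ≤ M) :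
    ∫ z, g z ∂(idealLaw ρ) =
      1 / Real.pi * ∫ φ in Set.Icc 0 Real.pi, ∫ x, (quadDens ρ x φ : ℂ) * g (x, φ) := by
  have hi : Integrable (fun z : ℝ × ℝ => (quadDens ρ z.1 z.2 : ℂ) * g z)
      (volume.prod (volume.restrict (Set.Icc 0 Real.pi))) :=
    (h.integrable_quadDens_prod hρ).ofReal.mul_bdd (c := M) hg.aestronglyMeasurable
      (Eventually.of_forall hM)
  rw [h.idealLaw_eq, integral_withDensity_eq_integral_toReal_smul h.measurable_ofReal_quadDens
    (Eventually.of_forall fun z => ENNReal.ofReal_lt_top), integral_smul_measure]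
  have e : ∀ z : ℝ × ℝ, (ENNReal.ofReal (quadDens ρ z.1 z.2)).toReal • g z =
      (quadDens ρ z.1 z.2 : ℂ) * g z := fun z => by
    rw [ENNReal.toReal_ofReal (h.quadDens_nonneg hρ _ _), Complex.real_smul]
  simp_rw [e]
  rw [integral_prod_symm _ hi, ENNReal.toReal_ofReal (by positivity), Complex.real_smul]
  push_cast
  rfl

lemma isProbabilityMeasure_noisyLaw (h : HasDecay ρ B s b ε C) (hρ : IsState ρ) (η : ℝ) :
    IsProbabilityMeasure (noisyLaw η ρ) := by
  have := h.isProbabilityMeasure_idealLaw hρ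
  unfold noisyLaw
  exact Measure.isProbabilityMeasure_map (Measurable.aemeasurable (by fun_prop))

lemma integral_phase_gaussian (a : ℝ) :
    ∫ x, Complex.exp (Complex.I * ((a * x : ℝ) : ℂ)) ∂(gaussianReal 0 1) =
      (Real.exp (-(a ^ 2 / 2)) : ℂ) := by
  have h := charFun_gaussianReal (μ := 0) (v := 1) a
  rw [charFun_apply_real] at h
  refine Eq.trans ?_ (h.trans ?_)
  · congr 1
    ext x
    congr 1
    push_cast
    ring
  · push_cast
    congr 1
    simp

/-- The Fourier transform of the law of the observations. -/
lemma integral_phase_noisyLaw (h : HasDecay ρ B s b ε C) (hρ : IsState ρ) {η γ : ℝ} (hη0 : 0 < η)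
    (hη1 : η < 1) (hγ : γ = (1 - η) / (4 * η)) (q p t : ℝ) :
    ∫ y, Complex.exp (-(Complex.I * (((q * Real.cos y.2 + p * Real.sin y.2
      - y.1 / Real.sqrt η) * t : ℝ) : ℂ))) ∂(noisyLaw η ρ) =
    (Real.exp (-(γ * t ^ 2)) : ℂ) * (1 / Real.pi * ∫ φ in Set.Icc 0 Real.pi,
      Complex.exp (-(Complex.I * ((q * (t * Real.cos φ) + p * (t * Real.sin φ) : ℝ) : ℂ))) *
        wignerFourier ρ (-t * Real.cos φ) (-t * Real.sin φ)) := by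
  have := h.isProbabilityMeasure_idealLaw hρ
  have hsη : 0 < Real.sqrt η := Real.sqrt_pos.2 hη0
  set a := t * (Real.sqrt ((1 - η) / 2) / Real.sqrt η) with ha
  -- After division by √η the noise has standard deviation √((1-η)/(2η)), so its characteristic
  -- function at `t` is exactly the reciprocal of the kernel weight e^{γt²}.
  have ha2 : a ^ 2 / 2 = γ * t ^ 2 := by
    rw [ha, mul_pow, div_pow, Real.sq_sqrt (by linarith), Real.sq_sqrt hη0.le, hγ]
    field_simp
    ring
  set g : ℝ × ℝ → ℂ := fun z => Complex.exp (-(Complex.I * (((q * Real.cos z.2 + p * Real.sin z.2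
      - z.1) * t : ℝ) : ℂ))) with hg
  have hgc : Continuous g := by fun_prop
  unfold noisyLaw
  rw [integral_map (Measurable.aemeasurable (by fun_prop))
    (Continuous.aestronglyMeasurable (by fun_prop))]
  have e1 : ∀ ω : (ℝ × ℝ) × ℝ, Complex.exp (-(Complex.I * (((q * Real.cos ω.1.2
      + p * Real.sin ω.1.2 - (Real.sqrt η * ω.1.1 + Real.sqrt ((1 - η) / 2) * ω.2) / Real.sqrt η)
        * t : ℝ) : ℂ))) = g ω.1 * Complex.exp (Complex.I * ((a * ω.2 : ℝ) : ℂ)) := fun ω => by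
    rw [hg, ← Complex.exp_add]
    congr 1
    have : (Real.sqrt η * ω.1.1 + Real.sqrt ((1 - η) / 2) * ω.2) / Real.sqrt η =
        ω.1.1 + Real.sqrt ((1 - η) / 2) / Real.sqrt η * ω.2 := by field_simp
    rw [this, ha]
    push_cast
    ring
  refine (integral_congr_ae (Eventually.of_forall e1)).trans ?_
  rw [integral_prod_mul g (fun x : ℝ => Complex.exp (Complex.I * ((a * x : ℝ) : ℂ))),
    integral_phase_gaussian, ha2, mul_comm,
    h.integral_idealLaw hρ hgc (M := 1) (fun z => (norm_phase_neg _).le)]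
  congr 2
  refine setIntegral_congr_fun measurableSet_Icc fun φ _ => ?_
  rw [← h.integral_phase_mul_quadDensC (-t) φ, ← integral_const_mul]
  congr 1
  ext x
  rw [h.quadDensC_eq hρ, ← mul_assoc, ← Complex.exp_add, mul_comm, hg]
  simp only
  congr 2
  push_cast
  ring

end HasDecay

/-! ### Polar coordinates with signed radius -/

/-- Angles in (0, π) with nonzero radii of both signs cover the plane once, apart from the
horizontal axis, which is null: positive radii give the upper half-plane and negative radii the
lower one. Positivity of the sine on this interval makes the map injective. The Jacobian |t|
explains the factor |t| in the estimator kernel. -/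
lemma setIntegral_signed_polar (f : ℝ × ℝ → ℂ) :
    ∫ p in ({0}ᶜ : Set ℝ) ×ˢ Set.Ioo 0 Real.pi, |p.1| • f (p.1 * Real.cos p.2, p.1 * Real.sin p.2) =
      ∫ w, f w := by
  set S : Set (ℝ × ℝ) := ({0}ᶜ : Set ℝ) ×ˢ Set.Ioo 0 Real.pi with hS
  have hSm : MeasurableSet S := (measurableSet_singleton 0).compl.prod measurableSet_Ioo
  have hinj : Set.InjOn polarCoord.symm S := by
    rintro ⟨r, φ⟩ ⟨hr, hφ⟩ ⟨r', φ'⟩ ⟨hr', hφ'⟩ heq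
    simp only [polarCoord_symm_apply, Prod.mk.injEq] at heq
    obtain ⟨h1, h2⟩ := heq
    simp only [Set.mem_compl_iff, Set.mem_singleton_iff] at hr hr' hφ hφ'
    have s1 := Real.sin_pos_of_pos_of_lt_pi hφ.1 hφ.2
    have s2 := Real.sin_pos_of_pos_of_lt_pi hφ'.1 hφ'.2
    have hsq : r ^ 2 = r' ^ 2 := by
      have a1 := Real.sin_sq_add_cos_sq φ
      have a2 := Real.sin_sq_add_cos_sq φ'
      linear_combination (-r ^ 2) * a1 + r' ^ 2 * a2 + (r * Real.cos φ + r' * Real.cos φ') * h1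
        + (r * Real.sin φ + r' * Real.sin φ') * h2
    have hrr : r = r' := by
      rcases sq_eq_sq_iff_eq_or_eq_neg.1 hsq with h | h
      · exact h
      · exfalso
        rw [h] at h2
        have : r' * (Real.sin φ + Real.sin φ') = 0 := by linarith
        rcases mul_eq_zero.1 this with h3 | h3
        · exact hr' h3
        · linarith
    subst hrr
    have hcos : Real.cos φ = Real.cos φ' := mul_left_cancel₀ hr h1
    rw [Real.injOn_cos ⟨hφ.1.le, hφ.2.le⟩ ⟨hφ'.1.le, hφ'.2.le⟩ hcos]
  have himg : polarCoord.symm '' S =ᵐ[volume] Set.univ := by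
    have hsub : {w : ℝ × ℝ | w.2 ≠ 0} ⊆ polarCoord.symm '' S := by
      intro w hw
      have hws : w ∈ polarCoord.source := Or.inr hw
      have hp := polarCoord.map_source hws
      have hpw := polarCoord.left_inv hws
      set p := polarCoord w
      obtain ⟨hp1, hp2⟩ : p.1 ∈ Set.Ioi (0 : ℝ) ∧ p.2 ∈ Set.Ioo (-Real.pi) Real.pi := hp
      have hne : p.2 ≠ 0 := fun h0 => hw (by rw [← hpw]; simp [polarCoord_symm_apply, h0])
      rcases lt_or_gt_of_ne hne with h | h
      · refine ⟨(-p.1, p.2 + Real.pi), ⟨?_, ?_, ?_⟩, ?_⟩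
        · simpa using (ne_of_gt hp1)
        · simp only; linarith [hp2.1]
        · simp only; linarith
        · rw [← hpw]
          simp [polarCoord_symm_apply, Real.cos_add_pi, Real.sin_add_pi]
      · exact ⟨p, ⟨ne_of_gt hp1, h, hp2.2⟩, hpw⟩
    have hnull : volume ({w : ℝ × ℝ | w.2 ≠ 0}ᶜ) = 0 := by
      have : ({w : ℝ × ℝ | w.2 ≠ 0}ᶜ) = (Set.univ : Set ℝ) ×ˢ ({0} : Set ℝ) := by
        ext w; simp
      rw [this, Measure.volume_eq_prod, Measure.prod_prod]
      simp
    rw [ae_eq_univ]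
    exact measure_mono_null (Set.compl_subset_compl.2 hsub) hnull
  have h := integral_image_eq_integral_abs_det_fderiv_smul volume hSm
    (fun p _ => (hasFDerivAt_polarCoord_symm p).hasFDerivWithinAt) hinj f
  rw [setIntegral_congr_set himg, setIntegral_univ] at h
  rw [h]
  simp_rw [det_fderivPolarCoordSymm]
  rfl

/-- The disc of the phase space, for a nonnegative radius. -/
def sqDisc (R : ℝ) : Set (ℝ × ℝ) := {w | w.1 ^ 2 + w.2 ^ 2 ≤ R ^ 2}

lemma measurableSet_sqDisc (R : ℝ) : MeasurableSet (sqDisc R) :=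
  (isClosed_le (by fun_prop) continuous_const).measurableSet

lemma disc_eq_sqDisc {R : ℝ} (hR : 0 ≤ R) : disc R = sqDisc R := by
  ext w
  simp only [disc, sqDisc, Set.mem_ofPred_eq]
  rw [Real.sqrt_le_left hR]

/-- The reflection w ↦ -w is inserted because the slices of `wignerFourier` occur at frequency -t.
-/
lemma integral_signed_polar_disc {g : ℝ × ℝ → ℂ} (hg : Continuous g) {R : ℝ} (hR : 0 ≤ R) :
    ∫ t in (-R)..R, ((|t| : ℝ) : ℂ) * ∫ φ in Set.Icc 0 Real.pi,
      g (-t * Real.cos φ, -t * Real.sin φ) = ∫ w in sqDisc R, g w := by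
  set H : ℝ × ℝ → ℂ := fun p => ((|p.1| : ℝ) : ℂ) * g (-p.1 * Real.cos p.2, -p.1 * Real.sin p.2) with hH
  have hHc : Continuous H := by fun_prop
  have h1 : ∫ w in sqDisc R, g w = ∫ w, (sqDisc R).indicator g (-w) := by
    rw [integral_neg_eq_self, integral_indicator (measurableSet_sqDisc R)]
  have h2 : ∀ p : ℝ × ℝ, |p.1| • (sqDisc R).indicator g
      (-(p.1 * Real.cos p.2, p.1 * Real.sin p.2)) =
      (Set.Icc (-R) R ×ˢ Set.univ).indicator H p := fun p => by
    have hmem : -(p.1 * Real.cos p.2, p.1 * Real.sin p.2) ∈ sqDisc R ↔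
        p ∈ Set.Icc (-R) R ×ˢ (Set.univ : Set ℝ) := by
      simp only [sqDisc, Set.mem_ofPred_eq, Prod.neg_mk, Set.mem_prod, Set.mem_univ, and_true,
        Set.mem_Icc]
      rw [← abs_le, ← sq_le_sq₀ (abs_nonneg _) hR, sq_abs]
      have : (-(p.1 * Real.cos p.2)) ^ 2 + (-(p.1 * Real.sin p.2)) ^ 2 = p.1 ^ 2 := by
        linear_combination p.1 ^ 2 * Real.sin_sq_add_cos_sq p.2
      rw [this]
    by_cases hp : p ∈ Set.Icc (-R) R ×ˢ (Set.univ : Set ℝ)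
    · rw [Set.indicator_of_mem hp, Set.indicator_of_mem (hmem.2 hp), Complex.real_smul, hH]
      simp
    · rw [Set.indicator_of_notMem hp, Set.indicator_of_notMem (fun h => hp (hmem.1 h)), smul_zero]
  have hset : (({0}ᶜ : Set ℝ) ×ˢ Set.Ioo 0 Real.pi ∩ Set.Icc (-R) R ×ˢ Set.univ : Set (ℝ × ℝ))
      =ᵐ[volume] (Set.Ioc (-R) R ×ˢ Set.Icc 0 Real.pi : Set (ℝ × ℝ)) := by
    rw [Set.prod_inter_prod, Set.inter_univ, Measure.volume_eq_prod]
    refine Measure.set_prod_ae_eq ?_ Ioo_ae_eq_Icc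
    have e1 : (({0}ᶜ : Set ℝ) ∩ Set.Icc (-R) R : Set ℝ) =ᵐ[volume]
        (Set.univ ∩ Set.Ioc (-R) R : Set ℝ) := by
      refine Filter.EventuallyEq.inter ?_ Ioc_ae_eq_Icc.symm
      rw [ae_eq_univ, compl_compl]
      simp
    rwa [Set.univ_inter] at e1
  have hint : IntegrableOn H (Set.Ioc (-R) R ×ˢ Set.Icc 0 Real.pi) (volume.prod volume) :=
    (hHc.continuousOn.integrableOn_compact (isCompact_Icc.prod isCompact_Icc)).mono_set
      (Set.prod_mono Set.Ioc_subset_Icc_self subset_rfl)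
  rw [h1, ← setIntegral_signed_polar]
  simp_rw [h2]
  rw [setIntegral_indicator (measurableSet_Icc.prod MeasurableSet.univ),
    setIntegral_congr_set hset, Measure.volume_eq_prod, setIntegral_prod _ hint,
    intervalIntegral.integral_of_le (by linarith)]
  congr 1
  ext t
  rw [hH]
  simp only
  rw [integral_const_mul]

/-! ### Bias -/

namespace HasDecay

variable {ρ : Matrix ℕ ℕ ℂ} {B s b ε C : ℝ}

/-- The expectation of the estimator: inverse Fourier transform with a spectral cut-off. -/
lemma integral_kernel_noisyLaw (hd : HasDecay ρ B s b ε C) (hρ : IsState ρ) {η γ : ℝ} (hη0 : 0 < η)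
    (hη1 : η < 1) (hγ : γ = (1 - η) / (4 * η)) {h : ℝ} (hh : 0 < h) (q p : ℝ) :
    ∫ y, kernel η h (q * Real.cos y.2 + p * Real.sin y.2 - y.1 / Real.sqrt η) ∂(noisyLaw η ρ) =
      (1 / (4 * (Real.pi : ℂ) ^ 2) * ∫ w in sqDisc (1 / h),
        Complex.exp (Complex.I * ((w.1 * q + w.2 * p : ℝ) : ℂ)) * wignerFourier ρ w.1 w.2).re := by
  have := hd.isProbabilityMeasure_noisyLaw hρ η
  have hR : 0 ≤ 1 / h := by positivity
  set R := 1 / h with hRdef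
  set P := noisyLaw η ρ
  set c : ℝ → ℂ := fun t => ((|t| * Real.exp (γ * t ^ 2) : ℝ) : ℂ) with hc
  set f : ℝ → ℝ × ℝ → ℂ := fun t y => Complex.exp (-(Complex.I * (((q * Real.cos y.2
    + p * Real.sin y.2 - y.1 / Real.sqrt η) * t : ℝ) : ℂ))) * c t with hf
  have hfc : Continuous (Function.uncurry f) := by
    simp only [hf, hc, Function.uncurry_def]
    fun_prop
  have hfi : Integrable (Function.uncurry f) ((volume.restrict (Set.uIoc (-R) R)).prod P) := by
    have h1 : Integrable (fun t : ℝ => |t| * Real.exp (γ * t ^ 2))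
        (volume.restrict (Set.uIoc (-R) R)) :=
      (Continuous.integrableOn_uIoc (by fun_prop))
    refine (h1.comp_fst P).mono' hfc.aestronglyMeasurable (Eventually.of_forall fun z => ?_)
    simp only [Function.uncurry_def, hf, hc]
    rw [norm_mul, norm_phase_neg, one_mul, Complex.norm_real, Real.norm_eq_abs,
      abs_of_nonneg (by positivity)]
  have hfi2 : Integrable (fun y => ∫ t in (-R)..R, f t y) P := by
    have := hfi.integral_prod_right
    refine this.congr (Eventually.of_forall fun y => ?_)
    simp only [Function.uncurry_def]
    rw [intervalIntegral.integral_of_le (by linarith), Set.uIoc_of_le (by linarith)]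
  have h1 : ∀ y : ℝ × ℝ, kernel η h (q * Real.cos y.2 + p * Real.sin y.2 - y.1 / Real.sqrt η) =
      Complex.reCLM (1 / (4 * (Real.pi : ℂ)) * ∫ t in (-R)..R, f t y) := fun y =>
    kernel_eq hη0 hη1 hγ h _
  simp_rw [h1]
  rw [ContinuousLinearMap.integral_comp_comm _ (hfi2.const_mul _), integral_const_mul,
    ← intervalIntegral_integral_swap hfi]
  change Complex.re _ = _
  set g : ℝ × ℝ → ℂ := fun w =>
    Complex.exp (Complex.I * ((w.1 * q + w.2 * p : ℝ) : ℂ)) * wignerFourier ρ w.1 w.2 with hg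
  have hgc : Continuous g := by
    have := hd.continuous_wignerFourier
    fun_prop
  have h2 : ∀ t : ℝ, ∫ y, f t y ∂P = 1 / (Real.pi : ℂ) * (((|t| : ℝ) : ℂ) *
      ∫ φ in Set.Icc 0 Real.pi, g (-t * Real.cos φ, -t * Real.sin φ)) := fun t => by
    -- Deconvolution: the kernel weight cancels the noise factor. The remaining 1/π combines with
    -- the 1/(4π) of the kernel into the inversion constant 1/(4π²).
    have e : Real.exp (γ * t ^ 2) * Real.exp (-(γ * t ^ 2)) = 1 := by rw [← Real.exp_add]; simp
    have e' : (Real.exp (γ * t ^ 2) : ℂ) * (Real.exp (-(γ * t ^ 2)) : ℂ) = 1 := by exact_mod_cast e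
    have e2 : ∀ φ : ℝ, g (-t * Real.cos φ, -t * Real.sin φ) =
        Complex.exp (-(Complex.I * ((q * (t * Real.cos φ) + p * (t * Real.sin φ) : ℝ) : ℂ))) *
        wignerFourier ρ (-t * Real.cos φ) (-t * Real.sin φ) := fun φ => by
      rw [hg]
      simp only
      congr 2
      push_cast
      ring
    simp only [hf]
    rw [integral_mul_const, hd.integral_phase_noisyLaw hρ hη0 hη1 hγ, hc]
    simp_rw [e2]
    rw [Complex.ofReal_mul]
    generalize ∫ φ in Set.Icc 0 Real.pi, Complex.exp (-(Complex.I *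
      ((q * (t * Real.cos φ) + p * (t * Real.sin φ) : ℝ) : ℂ))) *
        wignerFourier ρ (-t * Real.cos φ) (-t * Real.sin φ) = J
    linear_combination (1 / (Real.pi : ℂ) * J * ((|t| : ℝ) : ℂ)) * e'
  simp_rw [h2]
  rw [intervalIntegral.integral_const_mul, integral_signed_polar_disc hgc hR]
  congr 1
  have : (Real.pi : ℂ) ≠ 0 := by exact_mod_cast Real.pi_ne_zero
  field_simp

lemma phaseWeight_le_of_notMem {β R : ℝ} (hβ : 0 ≤ β) (hs : 0 ≤ s) {w : ℝ × ℝ}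
    (hw : w ∉ sqDisc R) : phaseWeight β s w ≤ Real.exp (-β * (R ^ 2 / 4) ^ s) := by
  simp only [sqDisc, Set.mem_ofPred_eq, not_le] at hw
  apply Real.exp_le_exp.2
  rw [neg_mul, neg_mul, neg_le_neg_iff]
  gcongr

/-- The pointwise bias of the estimator. -/
lemma abs_bias_le (hd : HasDecay ρ B s b ε C) (hρ : IsState ρ) {η γ : ℝ} (hη0 : 0 < η)
    (hη1 : η < 1) (hγ : γ = (1 - η) / (4 * η)) {h : ℝ} (hh : 0 < h) {β : ℝ} (hβ : 0 ≤ β)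
    (hβb : β < b) (q p : ℝ) :
    |(∫ y, kernel η h (q * Real.cos y.2 + p * Real.sin y.2 - y.1 / Real.sqrt η) ∂(noisyLaw η ρ))
      - wigner ρ q p| ≤ C * (∑' k, matrixWeight ε s k) * (∫ w, phaseWeight (b - β) s w) *
        Real.exp (-β * ((1 / h) ^ 2 / 4) ^ s) := by
  set R := 1 / h with hR
  set g : ℝ × ℝ → ℂ := fun w =>
    Complex.exp (Complex.I * ((w.1 * q + w.2 * p : ℝ) : ℂ)) * wignerFourier ρ w.1 w.2 with hg
  have hgn : ∀ w, ‖g w‖ = ‖wignerFourier ρ w.1 w.2‖ := fun w => norm_phase_mul _ _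
  have hgi : Integrable g := by
    refine hd.integrable_wignerFourier.mono (Continuous.aestronglyMeasurable ?_)
      (Eventually.of_forall fun w => (hgn w).le)
    have := hd.continuous_wignerFourier
    fun_prop
  have hiw := integrable_phaseWeight (b := b - β) (s := s) (by linarith) hd.pos_s
  have hA : 0 ≤ C * ∑' k, matrixWeight ε s k :=
    mul_nonneg hd.posC.le (tsum_nonneg fun k => (matrixWeight_pos ε s k).le)
  set K := C * ∑' k, matrixWeight ε s k with hK
  have hdiff : (∫ y, kernel η h (q * Real.cos y.2 + p * Real.sin y.2 - y.1 / Real.sqrt η)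
      ∂(noisyLaw η ρ)) - wigner ρ q p =
      (-(1 / (4 * (Real.pi : ℂ) ^ 2) * ∫ w in (sqDisc R)ᶜ, g w)).re := by
    rw [hd.integral_kernel_noisyLaw hρ hη0 hη1 hγ hh, wigner, ← Complex.sub_re]
    congr 1
    have := integral_add_compl (measurableSet_sqDisc R) hgi
    linear_combination (1 / (4 * (Real.pi : ℂ) ^ 2)) * this
  rw [hdiff]
  refine (Complex.abs_re_le_norm _).trans ?_
  rw [norm_neg, norm_mul]
  have hpi : ‖(1 / (4 * (Real.pi : ℂ) ^ 2) : ℂ)‖ ≤ 1 := by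
    rw [norm_div, norm_one, norm_mul, norm_pow, Complex.norm_real, Real.norm_eq_abs,
      abs_of_pos Real.pi_pos, Complex.norm_ofNat, div_le_one (by positivity)]
    nlinarith [Real.pi_gt_three]
  refine (mul_le_of_le_one_left (norm_nonneg _) hpi).trans ?_
  calc ‖∫ w in (sqDisc R)ᶜ, g w‖ ≤ ∫ w in (sqDisc R)ᶜ,
        K * Real.exp (-β * (R ^ 2 / 4) ^ s) * phaseWeight (b - β) s w := by
        refine norm_integral_le_of_norm_le (hiw.const_mul _).integrableOn ?_
        refine (ae_restrict_iff' (measurableSet_sqDisc R).compl).2 (Eventually.of_forall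
          fun w hw => ?_)
        rw [hgn]
        refine (hd.norm_wignerFourier_le w).trans ?_
        -- Of the rate b, the part β is evaluated on the boundary of the disc and gives the bias,
        -- while the part b - β keeps the integral finite.
        have h1 : phaseWeight b s w = phaseWeight β s w * phaseWeight (b - β) s w := by
          rw [← phaseWeight_add]; ring_nf
        rw [h1, ← hK, ← mul_assoc]
        have h2 := phaseWeight_le_of_notMem hβ hd.pos_s.le hw
        have h3 := phaseWeight_pos (b - β) s w
        gcongr
    _ ≤ ∫ w, K * Real.exp (-β * (R ^ 2 / 4) ^ s) * phaseWeight (b - β) s w :=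
        setIntegral_le_integral (hiw.const_mul _) (Eventually.of_forall fun w =>
          mul_nonneg (mul_nonneg hA (Real.exp_pos _).le) (phaseWeight_pos _ _ _).le)
    _ = _ := by rw [integral_const_mul]; ring

end HasDecay

/-! ### Risk -/

/-- Mean squared error is variance plus squared bias. By independence the variance of the average is
that of one term over n, and a variable with values in [-M, M] has variance at most M² by
Popoviciu's inequality. -/
lemma integral_mean_sub_sq_le {Ω : Type*} [MeasurableSpace Ω] {P : Measure Ω}
    [IsProbabilityMeasure P] {g : Ω → ℝ} (hg : Measurable g) {M : ℝ} (hM : ∀ y, |g y| ≤ M)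
    {n : ℕ} (hn : 0 < n) (w : ℝ) :
    ∫ d : Fin n → Ω, (1 / (n : ℝ) * ∑ l, g (d l) - w) ^ 2 ∂(Measure.pi fun _ => P) ≤
      M ^ 2 / n + (∫ y, g y ∂P - w) ^ 2 := by
  have hgL : MemLp g 2 P := MemLp.of_bound hg.aestronglyMeasurable M (Eventually.of_forall hM)
  have hgi : Integrable g P := hgL.integrable one_le_two
  set Q : Measure (Fin n → Ω) := Measure.pi fun _ => P
  set S : (Fin n → Ω) → ℝ := ∑ l : Fin n, fun d => g (d l) with hS
  have hSL : MemLp S 2 Q := memLp_finsetSum' _ fun l _ =>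
    hgL.comp_measurePreserving (measurePreserving_eval _ l)
  have hSi : Integrable S Q := hSL.integrable one_le_two
  have hES : ∫ d, S d ∂Q = n * ∫ y, g y ∂P := by
    simp only [hS, Finset.sum_apply]
    have hli : ∀ l : Fin n, Integrable (fun d : Fin n → Ω => g (d l)) Q := fun l =>
      (hgL.comp_measurePreserving (measurePreserving_eval _ l)).integrable one_le_two
    rw [integral_finsetSum _ fun l _ => hli l]
    have : ∀ l : Fin n, ∫ d : Fin n → Ω, g (d l) ∂Q = ∫ y, g y ∂P := fun l => by
      rw [← (measurePreserving_eval (fun _ : Fin n => P) l).map_eq,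
        integral_map (measurable_pi_apply l).aemeasurable hg.aestronglyMeasurable]
    simp [this]
  have hvar : Var[S; Q] ≤ n * M ^ 2 := by
    have h1 := variance_sum_pi (μ := fun _ : Fin n => P) (X := fun _ : Fin n => g) fun _ => hgL
    rw [h1]
    have h2 : Var[g; P] ≤ M ^ 2 := by
      have := variance_le_sq_of_bounded (μ := P) (X := g) (a := -M) (b := M)
        (Eventually.of_forall fun y => abs_le.1 (hM y)) hg.aemeasurable
      calc _ ≤ ((M - -M) / 2) ^ 2 := this
        _ = _ := by ring
    simp only [Finset.sum_const, Finset.card_univ, Fintype.card_fin, nsmul_eq_mul]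
    gcongr
  have hn' : (n : ℝ) ≠ 0 := by positivity
  have hexp : ∫ d, (1 / (n : ℝ) * ∑ l, g (d l) - w) ^ 2 ∂Q =
      (∫ d, S d ^ 2 ∂Q) / n ^ 2 - 2 * w / n * (∫ d, S d ∂Q) + w ^ 2 := by
    have e : ∀ d : Fin n → Ω, (1 / (n : ℝ) * ∑ l, g (d l) - w) ^ 2 =
        1 / (n : ℝ) ^ 2 * S d ^ 2 - 2 * w / n * S d + w ^ 2 := fun d => by
      simp only [hS, Finset.sum_apply]
      field_simp
      ring
    simp_rw [e]
    have i1 : Integrable (fun d => 1 / (n : ℝ) ^ 2 * S d ^ 2) Q := hSL.integrable_sq.const_mul _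
    have i2 : Integrable (fun d => 2 * w / n * S d) Q := hSi.const_mul _
    rw [integral_add (f := fun d => _ - _) (i1.sub i2) (integrable_const _), integral_sub i1 i2,
      integral_const_mul, integral_const_mul]
    simp
    ring
  have hv := variance_eq_sub hSL
  have hv' : ∫ d, S d ^ 2 ∂Q = Var[S; Q] + (n * ∫ y, g y ∂P) ^ 2 := by
    rw [hv, hES]
    simp
  rw [hexp, hv', hES]
  have e2 : (Var[S; Q] + (n * ∫ y, g y ∂P) ^ 2) / (n : ℝ) ^ 2 - 2 * w / n * (n * ∫ y, g y ∂P) + w ^ 2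
      = Var[S; Q] / n ^ 2 + (∫ y, g y ∂P - w) ^ 2 := by
    field_simp
    ring
  rw [e2]
  have : Var[S; Q] / (n : ℝ) ^ 2 ≤ M ^ 2 / n := by
    rw [div_le_div_iff₀ (by positivity) (by positivity)]
    have hn0 : (0 : ℝ) < n := by positivity
    nlinarith
  linarith

lemma phaseWeight_parity_le {b s : ℝ} (hb : 0 ≤ b) (hs : 0 ≤ s) (z : ℝ × ℝ) :
    phaseWeight b s (-2 * z.2, 2 * z.1) ≤ phaseWeight b s z := by
  apply Real.exp_le_exp.2
  refine mul_le_mul_of_nonpos_left (Real.rpow_le_rpow (by positivity) ?_ hs) (neg_nonpos.2 hb)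
  simp only
  nlinarith [sq_nonneg z.1, sq_nonneg z.2]

lemma volume_disc_le {R : ℝ} (hR : 0 ≤ R) : volume (disc R) ≤ ENNReal.ofReal ((2 * R) ^ 2) := by
  have hsub : disc R ⊆ Set.Icc (-R) R ×ˢ Set.Icc (-R) R := by
    rw [disc_eq_sqDisc hR]
    intro w hw
    simp only [sqDisc, Set.mem_ofPred_eq] at hw
    refine ⟨abs_le.1 (abs_le_of_sq_le_sq ?_ hR), abs_le.1 (abs_le_of_sq_le_sq ?_ hR)⟩
    · nlinarith [sq_nonneg w.2]
    · nlinarith [sq_nonneg w.1]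
  refine (measure_mono hsub).trans (le_of_eq ?_)
  rw [Measure.volume_eq_prod, Measure.prod_prod, Real.volume_Icc,
    ← ENNReal.ofReal_mul (by linarith)]
  ring_nf

lemma measurable_truncEstimator {η γ : ℝ} (hη0 : 0 < η) (hη1 : η < 1) (hγ : γ = (1 - η) / (4 * η))
    (h : ℝ) {R : ℝ} (hR : 0 ≤ R) (n : ℕ) :
    Measurable fun x : (Fin n → ℝ × ℝ) × (ℝ × ℝ) => truncEstimator η h R x.1 x.2 := by
  have hk := continuous_kernel hη0 hη1 hγ h
  have h1 : Measurable fun x : (Fin n → ℝ × ℝ) × (ℝ × ℝ) => estimator η h x.1 x.2.1 x.2.2 := by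
    unfold estimator
    refine Continuous.measurable (continuous_const.mul (continuous_finsetSum _ fun l _ => ?_))
    exact hk.comp (by fun_prop)
  have h2 : MeasurableSet (Prod.snd ⁻¹' disc R : Set ((Fin n → ℝ × ℝ) × (ℝ × ℝ))) := by
    rw [disc_eq_sqDisc hR]
    exact measurable_snd (measurableSet_sqDisc R)
  exact h1.indicator h2

lemma HasDecay.lintegral_wigner_sq_le {ρ : Matrix ℕ ℕ ℂ} {B s b ε C : ℝ}
    (hd : HasDecay ρ B s b ε C) {β : ℝ} (hβ : 0 ≤ β) (hβb : β < b) (R : ℝ) :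
    ∫⁻ z in (sqDisc R)ᶜ, ENNReal.ofReal (wigner ρ z.1 z.2 ^ 2) ≤
      ENNReal.ofReal ((C * (∑' k, matrixWeight ε s k) * Real.exp (-β * (R ^ 2 / 4) ^ s)) ^ 2 *
        ∫ w, phaseWeight (b - β) s w) := by
  have hiw := integrable_phaseWeight (b := b - β) (s := s) (by linarith) hd.pos_s
  have hA : 0 ≤ C * ∑' k, matrixWeight ε s k :=
    mul_nonneg hd.posC.le (tsum_nonneg fun k => (matrixWeight_pos ε s k).le)
  set K := C * ∑' k, matrixWeight ε s k with hK
  set D := Real.exp (-β * (R ^ 2 / 4) ^ s) with hD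
  have hpt : ∀ z ∈ (sqDisc R)ᶜ, ENNReal.ofReal (wigner ρ z.1 z.2 ^ 2) ≤
      ENNReal.ofReal ((K * D) ^ 2 * phaseWeight (b - β) s z) := fun z hz => by
    apply ENNReal.ofReal_le_ofReal
    have hG := phaseWeight_pos (b - β) s z
    have hG1 := phaseWeight_le_one (b := b - β) (by linarith) s z
    have h1 : |wigner ρ z.1 z.2| ≤ K * D * phaseWeight (b - β) s z := by
      calc |wigner ρ z.1 z.2| ≤ K * phaseWeight b s (-2 * z.2, 2 * z.1) := hd.abs_wigner_le _ _
        _ ≤ K * phaseWeight b s z := by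
          gcongr
          exact phaseWeight_parity_le hd.pos_b.le hd.pos_s.le z
        _ = K * (phaseWeight β s z * phaseWeight (b - β) s z) := by
          rw [← phaseWeight_add]; ring_nf
        _ ≤ K * (D * phaseWeight (b - β) s z) := by
          gcongr
          exact phaseWeight_le_of_notMem hβ hd.pos_s.le hz
        _ = _ := by ring
    rw [← sq_abs]
    calc |wigner ρ z.1 z.2| ^ 2 ≤ (K * D * phaseWeight (b - β) s z) ^ 2 := by gcongr
      _ = (K * D) ^ 2 * (phaseWeight (b - β) s z * phaseWeight (b - β) s z) := by ring
      _ ≤ (K * D) ^ 2 * (phaseWeight (b - β) s z * 1) := by gcongr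
      _ = _ := by rw [mul_one]
  refine (setLIntegral_mono' (measurableSet_sqDisc R).compl hpt).trans ?_
  refine (setLIntegral_le_lintegral _ _).trans (le_of_eq ?_)
  rw [← ofReal_integral_eq_lintegral_ofReal (hiw.const_mul _) (Eventually.of_forall fun z =>
    mul_nonneg (sq_nonneg _) (phaseWeight_pos _ _ _).le), integral_const_mul]

/-- Bias-variance bound for the risk of the truncated estimator. -/
lemma HasDecay.risk_le {ρ : Matrix ℕ ℕ ℂ} {B s b ε C : ℝ}
    (hd : HasDecay ρ B s b ε C) (hρ : IsState ρ) {η γ : ℝ} (hη0 : 0 < η)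
    (hη1 : η < 1) (hγ : γ = (1 - η) / (4 * η)) {h : ℝ} (hh : 0 < h) {β : ℝ} (hβ : 0 ≤ β)
    (hβb : β < b) {n : ℕ} (hn : 0 < n) :
    risk η h (1 / h) n ρ ≤ ENNReal.ofReal (
      (2 * (1 / h)) ^ 2 * ((Real.exp (γ / h ^ 2) / γ) ^ 2 / n +
        (C * (∑' k, matrixWeight ε s k) * (∫ w, phaseWeight (b - β) s w) *
          Real.exp (-β * ((1 / h) ^ 2 / 4) ^ s)) ^ 2) +
      (C * (∑' k, matrixWeight ε s k) * Real.exp (-β * ((1 / h) ^ 2 / 4) ^ s)) ^ 2 *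
        ∫ w, phaseWeight (b - β) s w) := by
  have hR : 0 ≤ 1 / h := by positivity
  have := hd.isProbabilityMeasure_noisyLaw hρ η
  have hI : 0 ≤ ∫ w, phaseWeight (b - β) s w := integral_nonneg fun w => (phaseWeight_pos _ _ w).le
  have hmeas : Measurable (Function.uncurry fun (d : Fin n → ℝ × ℝ) (z : ℝ × ℝ) =>
      ENNReal.ofReal ((truncEstimator η h (1 / h) d z - wigner ρ z.1 z.2) ^ 2)) :=
    (((measurable_truncEstimator hη0 hη1 hγ h hR n).sub
      (hd.continuous_wigner.measurable.comp measurable_snd)).pow_const 2).ennreal_ofReal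
  unfold risk
  -- By Tonelli, the risk is the integral over phase space of the pointwise mean squared error.
  -- Inside the disc this error is bounded uniformly, so only the area of the disc enters; outside,
  -- the estimator is zero.
  rw [lintegral_lintegral_swap hmeas.aemeasurable,
    ← lintegral_add_compl _ (measurableSet_sqDisc (1 / h)), ENNReal.ofReal_add (by positivity)
      (by positivity)]
  refine add_le_add ?_ ?_
  · have hpt : ∀ z ∈ sqDisc (1 / h), ∫⁻ d : Fin n → ℝ × ℝ,
        ENNReal.ofReal ((truncEstimator η h (1 / h) d z - wigner ρ z.1 z.2) ^ 2)
          ∂(Measure.pi fun _ => noisyLaw η ρ) ≤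
        ENNReal.ofReal ((Real.exp (γ / h ^ 2) / γ) ^ 2 / n +
        (C * (∑' k, matrixWeight ε s k) * (∫ w, phaseWeight (b - β) s w) *
          Real.exp (-β * ((1 / h) ^ 2 / 4) ^ s)) ^ 2) := fun z hz => by
      have hzd : z ∈ disc (1 / h) := by rwa [disc_eq_sqDisc hR]
      set g : ℝ × ℝ → ℝ := fun y =>
        kernel η h (z.1 * Real.cos y.2 + z.2 * Real.sin y.2 - y.1 / Real.sqrt η) with hg
      have hgm : Continuous g := (continuous_kernel hη0 hη1 hγ h).comp (by fun_prop)
      have hgb : ∀ y, |g y| ≤ Real.exp (γ / h ^ 2) / γ := fun y => abs_kernel_le hη0 hη1 hγ hh _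
      have e : ∀ d : Fin n → ℝ × ℝ, truncEstimator η h (1 / h) d z =
          1 / (n : ℝ) * ∑ l, g (d l) := fun d => by
        rw [truncEstimator, Set.indicator_of_mem hzd, estimator]
      simp_rw [e]
      have hmb : ∀ d : Fin n → ℝ × ℝ, |1 / (n : ℝ) * ∑ l, g (d l)| ≤
          Real.exp (γ / h ^ 2) / γ := fun d => by
        rw [abs_mul, abs_of_nonneg (by positivity), one_div, inv_mul_le_iff₀ (by positivity)]
        refine (Finset.abs_sum_le_sum_abs _ _).trans ((Finset.sum_le_sum fun l _ =>
          hgb (d l)).trans (by simp))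
      have hint : Integrable (fun d : Fin n → ℝ × ℝ =>
          (1 / (n : ℝ) * ∑ l, g (d l) - wigner ρ z.1 z.2) ^ 2)
          (Measure.pi fun _ => noisyLaw η ρ) := by
        refine Integrable.of_bound (Continuous.aestronglyMeasurable (by fun_prop))
          ((Real.exp (γ / h ^ 2) / γ + |wigner ρ z.1 z.2|) ^ 2) (Eventually.of_forall fun d => ?_)
        rw [Real.norm_eq_abs, abs_pow]
        refine pow_le_pow_left₀ (abs_nonneg _) ?_ 2
        exact (abs_sub _ _).trans (add_le_add_left (hmb d) _)
      rw [← ofReal_integral_eq_lintegral_ofReal hint (Eventually.of_forall fun d => sq_nonneg _)]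
      apply ENNReal.ofReal_le_ofReal
      refine (integral_mean_sub_sq_le hgm.measurable hgb hn _).trans ?_
      have hb := hd.abs_bias_le hρ hη0 hη1 hγ hh hβ hβb z.1 z.2
      refine add_le_add le_rfl ?_
      exact sq_le_sq.2 (hb.trans (le_abs_self _))
    refine (setLIntegral_mono' (measurableSet_sqDisc _) hpt).trans ?_
    rw [setLIntegral_const, mul_comm, ENNReal.ofReal_mul (by positivity)]
    gcongr
    rw [← disc_eq_sqDisc hR]
    exact volume_disc_le hR
  · refine le_trans (le_of_eq (setLIntegral_congr_fun (measurableSet_sqDisc _).compl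
      fun z hz => ?_)) (hd.lintegral_wigner_sq_le hβ hβb (1 / h))
    have hzd : z ∉ disc (1 / h) := by rwa [disc_eq_sqDisc hR]
    simp only [truncEstimator, Set.indicator_of_notMem hzd, zero_sub, neg_sq, lintegral_const,
      measure_univ, mul_one]

/-- The uniform risk bound over the class. -/
lemma exists_risk_le {B r b ε C : ℝ} (hB : 0 < B) (hr : 0 < r) (hD : DecayPair B (r / 2) b ε C)
    {η γ : ℝ} (hη0 : 0 < η) (hη1 : η < 1) (hγ : γ = (1 - η) / (4 * η)) {β : ℝ} (hβ : 0 ≤ β)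
    (hβb : β < b) :
    ∃ A : ℝ, 0 < A ∧ ∀ h : ℝ, 0 < h → h ≤ 1 → ∀ n : ℕ, 0 < n → ∀ ρ ∈ stateClass B r,
      risk η h (1 / h) n ρ ≤ ENNReal.ofReal (A * (h ^ (-2 : ℝ) *
        (Real.exp (2 * γ / h ^ 2) / n + Real.exp (-((2 : ℝ) ^ (1 - r) * β / h ^ r))))) := by
  have hγ0 : 0 < γ := by rw [hγ]; exact div_pos (by linarith) (by linarith)
  set K := C * ∑' k, matrixWeight ε (r / 2) k with hK
  set I := ∫ w, phaseWeight (b - β) (r / 2) w with hI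
  have hI0 : 0 ≤ I := integral_nonneg fun w => (phaseWeight_pos _ _ w).le
  -- The three terms come from the variance over the disc, the bias over the disc and the Wigner
  -- tail; the factors 4 come from bounding the disc by the square of side 2/h.
  refine ⟨4 / γ ^ 2 + 4 * (K * I) ^ 2 + K ^ 2 * I, by positivity, fun h hh hh1 n hn ρ hρ => ?_⟩
  refine ((hD.hasDecay hB hr (by linarith) hρ).risk_le hρ.1 hη0 hη1 hγ hh hβ hβb hn).trans ?_
  apply ENNReal.ofReal_le_ofReal
  rw [← hK, ← hI]
  have e1 : Real.exp (γ / h ^ 2) ^ 2 = Real.exp (2 * γ / h ^ 2) := by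
    rw [← Real.exp_nat_mul]
    congr 1
    push_cast
    ring
  have e2 : Real.exp (-β * ((1 / h) ^ 2 / 4) ^ (r / 2)) ^ 2 =
      Real.exp (-((2 : ℝ) ^ (1 - r) * β / h ^ r)) := by
    have e3 : ((1 / h) ^ 2 / 4) ^ (r / 2) = 2 ^ (-r) * (h ^ r)⁻¹ := by
      have : (1 / h) ^ 2 / 4 = (2 * h) ^ (-2 : ℝ) := by
        rw [Real.rpow_neg (by positivity), Real.rpow_two]
        field_simp
        norm_num
      rw [this, ← Real.rpow_mul (by positivity), Real.mul_rpow (by norm_num) hh.le,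
        ← Real.rpow_neg hh.le]
      ring_nf
    rw [← Real.exp_nat_mul, e3, sub_eq_add_neg, Real.rpow_add (by norm_num), Real.rpow_one]
    congr 1
    push_cast
    ring
  have e4 : h ^ (-2 : ℝ) = (1 / h) ^ 2 := by
    rw [Real.rpow_neg hh.le, Real.rpow_two, one_div, inv_pow]
  rw [e4]
  set D := Real.exp (-β * ((1 / h) ^ 2 / 4) ^ (r / 2)) with hDdef
  rw [← e2, ← e1]
  -- The Wigner tail carries no area factor; since h ≤ 1 it can be bounded with the common factor
  -- h^{-2}.
  have hL : 1 ≤ (1 / h) ^ 2 := one_le_pow₀ (by rw [le_div_iff₀ hh]; linarith)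
  set L := (1 / h) ^ 2 with hLdef
  set E := Real.exp (γ / h ^ 2) ^ 2 / n with hE
  have hE0 : 0 ≤ E := by positivity
  have f1 : (2 * (1 / h)) ^ 2 = 4 * L := by rw [hLdef]; ring
  have f2 : (Real.exp (γ / h ^ 2) / γ) ^ 2 / n = E / γ ^ 2 := by rw [hE]; ring
  rw [f1, f2]
  have hD0 : 0 ≤ D ^ 2 := sq_nonneg D
  have g1 : K ^ 2 * I * D ^ 2 ≤ K ^ 2 * I * (L * D ^ 2) := by
    gcongr
    nlinarith
  have g2 : 0 ≤ 4 / γ ^ 2 * (L * D ^ 2) := by positivity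
  have g3 : 0 ≤ 4 * (K * I) ^ 2 * (L * E) := by positivity
  have g4 : 0 ≤ K ^ 2 * I * (L * E) := by positivity
  have g5 : 4 * L * (E / γ ^ 2 + (K * I * D) ^ 2) + (K * D) ^ 2 * I =
      4 / γ ^ 2 * (L * E) + 4 * (K * I) ^ 2 * (L * D ^ 2) + K ^ 2 * I * D ^ 2 := by ring
  rw [g5]
  nlinarith

/-! ### Rates -/

/-- Reduces both cases to a scalar comparison: the risk constant does not depend on ρ, so the
supremum over the class and the limit superior cost nothing. -/
lemma attainsRate_of_eventually_le {B r b ε C : ℝ} (hB : 0 < B) (hr : 0 < r)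
    (hD : DecayPair B (r / 2) b ε C) {η γ : ℝ} (hη0 : 0 < η) (hη1 : η < 1)
    (hγ : γ = (1 - η) / (4 * η)) {β : ℝ} (hβ : 0 ≤ β) (hβb : β < b) {h φ2 : ℕ → ℝ}
    (hφ : Tendsto φ2 atTop (𝓝 0)) (hφpos : ∀ᶠ n in atTop, 0 < φ2 n)
    (hh : ∀ᶠ n in atTop, 0 < h n ∧ h n ≤ 1) {A : ℝ} (hA : 0 < A)
    (hle : ∀ᶠ n : ℕ in atTop, h n ^ (-2 : ℝ) * (Real.exp (2 * γ / h n ^ 2) / n +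
      Real.exp (-((2 : ℝ) ^ (1 - r) * β / h n ^ r))) ≤ A * φ2 n) :
    AttainsRate B r η h (fun n => 1 / h n) φ2 := by
  obtain ⟨A', hA', hrisk⟩ := exists_risk_le hB hr hD hη0 hη1 hγ hβ hβb
  refine ⟨hφ, A' * A, by positivity, ?_⟩
  refine limsup_le_of_le (by isBoundedDefault) ?_
  filter_upwards [hφpos, hh, hle, eventually_gt_atTop 0] with n h1 h2 h3 h4
  refine ENNReal.div_le_of_le_mul ?_
  rw [← ENNReal.ofReal_mul (by positivity)]
  refine iSup₂_le fun ρ hρ => (hrisk (h n) h2.1 h2.2 n h4 ρ hρ).trans ?_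
  apply ENNReal.ofReal_le_ofReal
  rw [mul_assoc]
  gcongr

lemma tendsto_log_natCast : Tendsto (fun n : ℕ => Real.log n) atTop atTop :=
  Real.tendsto_log_atTop.comp tendsto_natCast_atTop_atTop

/-- Since (1+√B)² exceeds 1 + B by 2√B, β lies strictly below B/(1+B), which leaves room for a decay
rate b above β. The bandwidth makes h^{-2} of order log n and gives variance and bias the common
factor n^{-β/(4γ+β)}. -/
lemma attainsRate_two {B η γ β : ℝ} (hB : 0 < B) (hη0 : 0 < η) (hη1 : η < 1)
    (hγ : γ = (1 - η) / (4 * η)) (hβ : β = B / (1 + Real.sqrt B) ^ 2) {h : ℕ → ℝ}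
    (hh : ∀ n : ℕ, h n = (2 / (4 * γ + β) * Real.log n
        + 1 / (4 * γ + β) * Real.log (Real.log n)) ^ (-(1 / 2) : ℝ)) :
    AttainsRate B 2 η h (fun n => 1 / h n)
        (fun n => Real.log n ^ ((16 * γ + 3 * β) / (8 * γ + 2 * β))
          * (n : ℝ) ^ (-(β / (4 * γ + β)))) := by
  have hγ0 : 0 < γ := by rw [hγ]; exact div_pos (by linarith) (by linarith)
  have hsB : 0 < Real.sqrt B := Real.sqrt_pos.2 hB
  have hβ0 : 0 < β := by rw [hβ]; positivity
  have hβB : β < B / (1 + B) := by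
    rw [hβ]
    have : (1 + Real.sqrt B) ^ 2 = 1 + B + 2 * Real.sqrt B := by
      rw [add_sq, Real.sq_sqrt hB.le]; ring
    rw [this]
    exact div_lt_div_of_pos_left hB (by linarith) (by linarith)
  obtain ⟨b, hb1, hb2⟩ := exists_between hβB
  obtain ⟨ε, C, hD⟩ := exists_decayPair_one (hβ0.trans hb1) hb2 hB
  set c := 4 * γ + β with hc
  have hc0 : 0 < c := by rw [hc]; positivity
  have he : (16 * γ + 3 * β) / (8 * γ + 2 * β) = 2 - β / (2 * c) := by
    rw [hc]
    field_simp
    ring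
  rw [he]
  have hlog := tendsto_log_natCast
  refine attainsRate_of_eventually_le (A := 6 / c) hB two_pos (by norm_num; exact hD) hη0 hη1 hγ
    hβ0.le hb1 ?_ ?_ ?_ (by positivity) ?_
  · have h1 := ((isLittleO_log_rpow_rpow_atTop (2 - β / (2 * c))
      (div_pos hβ0 hc0)).tendsto_div_nhds_zero).comp tendsto_natCast_atTop_atTop
    refine h1.congr fun n => ?_
    simp only [Function.comp_apply]
    rw [Real.rpow_neg n.cast_nonneg, div_eq_mul_inv]
  · filter_upwards [hlog.eventually_gt_atTop 0, eventually_gt_atTop 0] with n h1 h2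
    positivity
  · filter_upwards [hlog.eventually_ge_atTop (max 1 c)] with n h1
    have hL : 1 ≤ Real.log n := (le_max_left _ _).trans h1
    have hLc : c ≤ Real.log n := (le_max_right _ _).trans h1
    have hLL := Real.log_nonneg hL
    have hx : 1 ≤ 2 / c * Real.log n + 1 / c * Real.log (Real.log n) := by
      have : 1 ≤ 2 / c * Real.log n := by
        rw [div_mul_eq_mul_div, le_div_iff₀ hc0]
        linarith
      have : 0 ≤ 1 / c * Real.log (Real.log n) := by positivity
      linarith
    rw [hh]
    exact ⟨Real.rpow_pos_of_pos (by linarith) _, Real.rpow_le_one_of_one_le_of_nonpos hx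
      (by norm_num)⟩
  · filter_upwards [hlog.eventually_ge_atTop 1, eventually_gt_atTop 0] with n hL hn
    set L := Real.log n with hLdef
    have hL0 : 0 < L := by linarith
    have hLL := Real.log_nonneg hL
    have hLl : Real.log L ≤ L := (Real.log_le_sub_one_of_pos hL0).trans (by linarith)
    set x := 2 / c * L + 1 / c * Real.log L with hx
    have hx0 : 0 < x := by positivity
    have hxL : x ≤ 3 / c * L := by
      have : 1 / c * Real.log L ≤ 1 / c * L := by gcongr
      have e : 3 / c * L = 2 / c * L + 1 / c * L := by ring
      linarith
    have hh2 : h n ^ 2 = x⁻¹ := by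
      rw [hh, ← hx, ← Real.rpow_two, ← Real.rpow_mul hx0.le]
      norm_num
      rw [Real.rpow_neg_one]
    have hpos : 0 < h n := by rw [hh]; exact Real.rpow_pos_of_pos hx0 _
    have hn0 : (0 : ℝ) < n := by exact_mod_cast hn
    have e1 : h n ^ (-2 : ℝ) = x := by
      rw [Real.rpow_neg hpos.le, Real.rpow_two, hh2, inv_inv]
    have e2 : Real.exp (2 * γ / h n ^ 2) / n = L ^ (2 * γ / c) * (n : ℝ) ^ (-(β / c)) := by
      rw [hh2, Real.rpow_def_of_pos hL0, Real.rpow_def_of_pos hn0, ← hLdef, ← Real.exp_add,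
        div_eq_mul_inv]
      nth_rewrite 1 [← Real.exp_log hn0]
      rw [← Real.exp_neg, ← Real.exp_add, ← hLdef, hx]
      congr 1
      have : β = c - 4 * γ := by rw [hc]; ring
      rw [this]
      field_simp
      ring
    have e3 : Real.exp (-((2 : ℝ) ^ (1 - 2 : ℝ) * β / h n ^ (2 : ℝ))) =
        L ^ (-(β / (2 * c))) * (n : ℝ) ^ (-(β / c)) := by
      rw [Real.rpow_two, hh2, Real.rpow_def_of_pos hL0, Real.rpow_def_of_pos hn0, ← hLdef,
        ← Real.exp_add, hx]
      congr 1
      have : (2 : ℝ) ^ (1 - 2 : ℝ) = 2⁻¹ := by norm_num [Real.rpow_neg_one]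
      rw [this]
      field_simp
      ring
    rw [e1, e2, e3, ← add_mul]
    have hnp : 0 < (n : ℝ) ^ (-(β / c)) := by positivity
    -- The two exponents differ by exactly 1/2, so the stated rate exceeds the variance term by a
    -- factor √(log n).
    have g1 : L * L ^ (2 * γ / c) ≤ L ^ (2 - β / (2 * c)) := by
      rw [mul_comm, ← Real.rpow_add_one hL0.ne']
      apply Real.rpow_le_rpow_of_exponent_le hL
      have : 2 - β / (2 * c) - (2 * γ / c + 1) = (4 * γ + β) / (2 * c) := by
        rw [hc]; field_simp; ring
      have : 0 ≤ (4 * γ + β) / (2 * c) := by positivity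
      linarith
    have g2 : L * L ^ (-(β / (2 * c))) ≤ L ^ (2 - β / (2 * c)) := by
      rw [mul_comm, ← Real.rpow_add_one hL0.ne']
      apply Real.rpow_le_rpow_of_exponent_le hL
      linarith
    calc x * ((L ^ (2 * γ / c) + L ^ (-(β / (2 * c)))) * (n : ℝ) ^ (-(β / c)))
        ≤ 3 / c * L * ((L ^ (2 * γ / c) + L ^ (-(β / (2 * c)))) * (n : ℝ) ^ (-(β / c))) := by
          gcongr
      _ = 3 / c * (L * L ^ (2 * γ / c) + L * L ^ (-(β / (2 * c)))) * (n : ℝ) ^ (-(β / c)) := by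
          ring
      _ ≤ 3 / c * (L ^ (2 - β / (2 * c)) + L ^ (2 - β / (2 * c))) * (n : ℝ) ^ (-(β / c)) := by
          gcongr
      _ = _ := by ring

/-! ### The implicitly defined bandwidth -/

lemma tendsto_log_sub_sq_log_log :
    Tendsto (fun n : ℕ => Real.log n - Real.log (Real.log n) ^ 2) atTop atTop := by
  have h1 : ∀ᶠ x : ℝ in atTop, x / 2 ≤ x - Real.log x ^ 2 := by
    have := (Real.isLittleO_pow_log_id_atTop (n := 2)).bound (by norm_num : (0 : ℝ) < 1 / 2)
    filter_upwards [this, eventually_ge_atTop 0] with x hx hx0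
    rw [Real.norm_eq_abs, Real.norm_eq_abs, abs_of_nonneg (sq_nonneg _), id, abs_of_nonneg hx0] at hx
    linarith
  exact (tendsto_atTop_mono' _ h1 (tendsto_id.atTop_div_const two_pos)).comp tendsto_log_natCast

lemma bandwidth_fun_lt {a γ r : ℝ} (ha : 0 < a) (hγ : 0 < γ) (hr : 0 < r) {h k : ℝ} (hh : 0 < h)
    (hk : h < k) : a / k ^ r + 2 * γ / k ^ 2 < a / h ^ r + 2 * γ / h ^ 2 := by
  have : h ^ r < k ^ r := Real.rpow_lt_rpow hh.le hk hr
  gcongr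

/-- The left side of the equation is continuous and strictly decreasing in h, so the intermediate
value theorem gives existence and monotonicity gives uniqueness. -/
lemma existsUnique_bandwidth {r β γ : ℝ} (hr : 0 < r) (hβ : 0 < β) (hγ : 0 < γ) :
    ∀ᶠ n : ℕ in atTop, ∃! h : ℝ, IsBandwidth r β γ n h := by
  set a := (2 : ℝ) ^ (1 - r) * β with ha
  have ha0 : 0 < a := by positivity
  filter_upwards [tendsto_log_sub_sq_log_log.eventually_ge_atTop (a + 2 * γ)] with n hn
  set T := Real.log n - Real.log (Real.log n) ^ 2 with hT
  have hT0 : 0 < T := by linarith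
  -- At this δ the quadratic term alone equals the right-hand side, so the full expression is at
  -- least as large; at 1 it is at most T by the choice of `n`.
  set δ := Real.sqrt (2 * γ / T) with hδ
  have hδ0 : 0 < δ := Real.sqrt_pos.2 (by positivity)
  have hδ1 : δ ≤ 1 := Real.sqrt_le_one.2 (by rw [div_le_one hT0]; linarith)
  have hcont : ContinuousOn (fun h : ℝ => a / h ^ r + 2 * γ / h ^ 2) (Set.Icc δ 1) := by
    refine ContinuousOn.add (ContinuousOn.div continuousOn_const ?_ ?_)
      (ContinuousOn.div continuousOn_const (by fun_prop) ?_)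
    · exact continuousOn_id.rpow_const fun x _ => Or.inr hr.le
    · intro x hx
      have : 0 < x := hδ0.trans_le hx.1
      positivity
    · intro x hx
      have : 0 < x := hδ0.trans_le hx.1
      positivity
  have hδT : T ≤ a / δ ^ r + 2 * γ / δ ^ 2 := by
    have e : 2 * γ / δ ^ 2 = T := by
      rw [hδ, Real.sq_sqrt (by positivity)]
      field_simp
    rw [e]
    have : 0 ≤ a / δ ^ r := by positivity
    linarith
  have h1T : a / (1 : ℝ) ^ r + 2 * γ / 1 ^ 2 ≤ T := by simpa using hn
  obtain ⟨h, hmem, hh⟩ := intermediate_value_Icc' hδ1 hcont ⟨h1T, hδT⟩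
  refine ⟨h, ⟨hδ0.trans_le hmem.1, hh⟩, fun k hk => ?_⟩
  have hh0 : 0 < h := hδ0.trans_le hmem.1
  have hkT : a / k ^ r + 2 * γ / k ^ 2 = T := hk.2
  simp only at hh
  rcases lt_trichotomy k h with hlt | heq | hgt
  · have := bandwidth_fun_lt ha0 hγ hr hk.1 hlt
    linarith
  · exact heq
  · have := bandwidth_fun_lt ha0 hγ hr hh0 hgt
    linarith

/-- The bandwidth equation makes the stochastic factor exp(2γ/h²)/n equal to the bias factor times
exp(-(log log n)²), so it is dominated by the bias. -/
lemma attainsRate_lt_two {B η γ r β : ℝ} (hη0 : 0 < η) (hη1 : η < 1)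
    (hγ : γ = (1 - η) / (4 * η)) (hr : 0 < r) (hr2 : r < 2) (hβ : 0 < β) (hβB : β < B) {h : ℕ → ℝ}
    (hh : ∀ᶠ n : ℕ in atTop, IsBandwidth r β γ n (h n)) :
    AttainsRate B r η h (fun n => 1 / h n)
      (fun n => h n ^ (3 * r - 10) * Real.exp (-((2 : ℝ) ^ (1 - r) * β / h n ^ r))) := by
  have hγ0 : 0 < γ := by rw [hγ]; exact div_pos (by linarith) (by linarith)
  obtain ⟨b, hb1, hb2⟩ := exists_between hβB
  obtain ⟨ε, C, hD⟩ := exists_decayPair_lt_one (s := r / 2) (by linarith) (by linarith)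
    (hβ.trans hb1) hb2
  set a := (2 : ℝ) ^ (1 - r) * β with ha
  have ha0 : 0 < a := by positivity
  have hT := tendsto_log_sub_sq_log_log
  have hle1 : ∀ᶠ n : ℕ in atTop, 0 < h n ∧ h n ≤ 1 := by
    filter_upwards [hh, hT.eventually_ge_atTop (a + 2 * γ)] with n h1 h2
    refine ⟨h1.1, not_lt.1 fun hlt => ?_⟩
    have h3 := bandwidth_fun_lt ha0 hγ0 hr one_pos hlt
    have h4 := h1.2
    simp only [Real.one_rpow, one_pow, div_one] at h3
    linarith
  -- For h ≤ 1 and r < 2 both terms of the equation are controlled by h^{-2}, so h^{-2} is at least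
  -- a multiple of the right-hand side, which tends to infinity.
  have hinv : Tendsto (fun n => (h n)⁻¹) atTop atTop := by
    have h1 : Tendsto (fun n : ℕ => Real.sqrt ((a + 2 * γ)⁻¹ *
        (Real.log n - Real.log (Real.log n) ^ 2))) atTop atTop :=
      Real.tendsto_sqrt_atTop.comp (hT.const_mul_atTop (by positivity))
    refine tendsto_atTop_mono' _ ?_ h1
    filter_upwards [hh, hle1] with n h2 h3
    rw [← h2.2, ← ha]
    have h4 : h n ^ 2 ≤ h n ^ r := by
      rw [← Real.rpow_two]
      exact Real.rpow_le_rpow_of_exponent_ge h3.1 h3.2 hr2.le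
    have h5 : a / h n ^ r ≤ a / h n ^ 2 := by
      have := h3.1
      gcongr
    refine Real.sqrt_le_iff.2 ⟨inv_nonneg.2 h3.1.le, ?_⟩
    rw [inv_mul_le_iff₀ (by positivity)]
    calc a / h n ^ r + 2 * γ / h n ^ 2 ≤ a / h n ^ 2 + 2 * γ / h n ^ 2 := by gcongr
      _ = (a + 2 * γ) * (h n)⁻¹ ^ 2 := by rw [inv_pow]; ring
  refine attainsRate_of_eventually_le (A := 2) (hβ.trans hβB) hr hD hη0 hη1 hγ
    hβ.le hb1 ?_ ?_ hle1 two_pos ?_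
  · have h1 := ((tendsto_rpow_mul_exp_neg_mul_atTop_nhds_zero ((10 - 3 * r) / r) a ha0).comp
      (tendsto_rpow_atTop hr)).comp hinv
    refine h1.congr' ?_
    filter_upwards [hle1] with n hn
    simp only [Function.comp_apply]
    rw [← Real.rpow_mul (inv_nonneg.2 hn.1.le), mul_div_cancel₀ _ hr.ne', Real.inv_rpow hn.1.le,
      Real.inv_rpow hn.1.le, ← Real.rpow_neg hn.1.le]
    ring_nf
  · filter_upwards [hle1] with n hn
    have := hn.1
    positivity
  · filter_upwards [hh, hle1, eventually_gt_atTop 0] with n h1 h2 h3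
    have hn0 : (0 : ℝ) < n := by exact_mod_cast h3
    have hpos := h2.1
    have e1 : Real.exp (2 * γ / h n ^ 2) / n ≤ Real.exp (-(a / h n ^ r)) := by
      nth_rewrite 1 [div_eq_mul_inv]
      nth_rewrite 1 [← Real.exp_log hn0]
      rw [← Real.exp_neg, ← Real.exp_add]
      apply Real.exp_le_exp.2
      have h4 := h1.2
      rw [← ha] at h4
      nlinarith [sq_nonneg (Real.log (Real.log n))]
    -- As r < 2, the exponent 3r - 10 is below -4, hence below -2, and powers of h ≤ 1 decrease in
    -- the exponent.
    have e2 : h n ^ (-2 : ℝ) ≤ h n ^ (3 * r - 10) :=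
      Real.rpow_le_rpow_of_exponent_ge h2.1 h2.2 (by linarith)
    calc h n ^ (-2 : ℝ) * (Real.exp (2 * γ / h n ^ 2) / n + Real.exp (-(a / h n ^ r)))
        ≤ h n ^ (3 * r - 10) * (Real.exp (-(a / h n ^ r)) + Real.exp (-(a / h n ^ r))) := by
          gcongr
      _ = _ := by ring

end QHT

end
theorem theorem4 (B η γ : ℝ) (hB : 0 < B) (hη0 : 0 < η) (hη1 : η < 1)
    (hγ : γ = (1 - η) / (4 * η)) :
    -- the case r = 2
    (∀ (β : ℝ) (h : ℕ → ℝ), β = B / (1 + Real.sqrt B) ^ 2 →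
      (∀ n : ℕ, h n = (2 / (4 * γ + β) * Real.log n
        + 1 / (4 * γ + β) * Real.log (Real.log n)) ^ (-(1 / 2) : ℝ)) →
      QHT.AttainsRate B 2 η h (fun n => 1 / h n)
        (fun n => Real.log n ^ ((16 * γ + 3 * β) / (8 * γ + 2 * β))
          * (n : ℝ) ^ (-(β / (4 * γ + β)))))
    ∧
    -- the case 0 < r < 2
    (∀ r β : ℝ, 0 < r → r < 2 → 0 < β → β < B →
      (∀ᶠ n : ℕ in Filter.atTop, ∃! h : ℝ, QHT.IsBandwidth r β γ n h) ∧
      ∀ h : ℕ → ℝ, (∀ᶠ n : ℕ in Filter.atTop, QHT.IsBandwidth r β γ n (h n)) →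
        QHT.AttainsRate B r η h (fun n => 1 / h n)
          (fun n => h n ^ (3 * r - 10) * Real.exp (-((2 : ℝ) ^ (1 - r) * β / h n ^ r)))) := by
  have hγ0 : 0 < γ := by rw [hγ]; exact div_pos (by linarith) (by linarith)
  exact ⟨fun β h hβ hh => QHT.attainsRate_two hB hη0 hη1 hγ hβ hh,
    fun r β hr hr2 hβ hβB => ⟨QHT.existsUnique_bandwidth hr hβ hγ0,
      fun h hh => QHT.attainsRate_lt_two hη0 hη1 hγ hr hr2 hβ hβB hh⟩⟩
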